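/- Let $\mathcal H$ be a real Hilbert space, let $N\ge 2$, let $\mathcal Q\subset\mathcal H$ be nonempty, closed and convex, let $h\colon\mathcal H\to\mathbb R$ be convex and differentiable with $\beta^{-1}$-Lipschitz gradient for some $\beta>0$, and let $f_1,\dots,f_N\colon\mathcal H\to\mathbb R$ be convex and lower semicontinuous. Let $\mathbf H=\mathcal H\times\mathbb R^N$ (Hilbert direct sum), let $\mathcal P_1=\{p\in\mathbb R^N:\sum_{i=1}^N p_i=1\}$, let $(e_i)$ be the canonical basis of $\mathbb R^N$, and let $\phi=\iota_{\mathbb R_-}$ be the indicator function of $\left]-\infty,0\right]$ (so that $\partial\phi^*=N_{\mathbb R_+}$). For $(x,p)\in\mathbf H$ define $$A_1(x,p)=N_{\mathcal Q}(x)\times N_{\mathcal P_1}(p),\quad B_i(x,p)=p_i\,\partial f_i(x)\times\big(\partial\phi^*(p_i)\,e_i-f_i(x)\,e_i\big)\ (1\le i\le N),\quad C(x,p)=(\nabla h(x),0),$$ $C_1=C$ and $C_i=0$ for $2\le i\le N$, where $N_{\mathcal Q}$, $N_{\mathcal P_1}$ denote normal cones, and consider the inclusion (the optimality condition of $\min_{x\in\mathcal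 Q}\{h(x)+\sup_{p\in\Delta_N}\sum_i p_if_i(x)\}$, with $\Delta_N$ the probability simplex) $$0\in A_1(x,p)+\sum_{i=1}^N B_i(x,p)+\sum_{i=1}^N C_i(x,p).\qquad(\ast)$$ Assume that $(\ast)$ has at least one solution. Let $\lambda\in\left]0,2\beta\right[$, let $\gamma\in\left]0,1-\frac{\lambda}{2\beta}\right[$, let $J_{\lambda B_i}=(\mathrm{Id}+\lambda B_i)^{-1}$, let $((\overline x_1^0,\overline p_1^0),\dots,(\overline x_N^0,\overline p_N^0))\in\mathbf H^N$ be arbitrary, and for every $k\in\mathbb N$ let $$\begin{aligned} &x_1^k=\mathrm{proj}_{\mathcal Q}(\overline x_1^k),\qquad p_1^k=\mathrm{proj}_{\mathcal P_1}(\overline p_1^k),\\ &(x_2^k,p_2^k)=J_{\lambda B_1}\big(\overline x_2^k+x_1^k-\overline x_1^k-\lambda\nabla h(x_1^k),\ \overline p_2^k+p_1^k-\overline p_1^k\big),\\ &(x_i^k,p_i^k)=J_{\lambda B_{i-1}}\big(\overline x_i^k+x_{i-1}^k-\overline x_{i-1}^k,\ \overline p_i^k+p_{i-1}^k-\overline p_{i-1}^k\big)\quad(3\le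 i\le N),\\ &(x_{N+1}^k,p_{N+1}^k)=J_{\lambda B_N}\big(x_1^k+x_N^k-\overline x_N^k,\ p_1^k+p_N^k-\overline p_N^k\big),\\ &\overline x_j^{k+1}=\overline x_j^k+\gamma(x_{j+1}^k-x_j^k),\qquad \overline p_j^{k+1}=\overline p_j^k+\gamma(p_{j+1}^k-p_j^k)\quad(1\le j\le N). \end{aligned}$$ Then there exists a solution $(x,p)\in\mathbf H$ of $(\ast)$ such that $(x_1^k,p_1^k)\rightharpoonup(x,p)$ weakly in $\mathbf H$. -/

import Mathlib

open Filter Set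
open scoped Topology Pointwise

namespace DRO

noncomputable section

/-- The Hilbert direct sum `H × ℝ^N`. -/
abbrev Space (H : Type*) [NormedAddCommGroup H] (N : ℕ) : Type _ :=
  WithLp 2 (H × EuclideanSpace ℝ (Fin N))

section Convex

variable {E : Type*} [NormedAddCommGroup E] [InnerProductSpace ℝ E]

/-- The convex subdifferential of an extended-real-valued function. -/
def subdifferential (f : E → EReal) (x : E) : Set E :=
  {u | ∀ y, f x + ((inner ℝ u (y - x) : ℝ) : EReal) ≤ f y}

/-- The Fenchel conjugate. -/
def conjugate (f : E → EReal) (u : E) : EReal :=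
  ⨆ x, (((inner ℝ x u : ℝ) : EReal) - f x)

open Classical in
/-- The indicator function of a set: `0` on the set and `+∞` outside. -/
def indicatorFun (Q : Set E) (x : E) : EReal := if x ∈ Q then 0 else ⊤

/-- The normal cone to `Q` (empty at points outside `Q`). -/
def normalCone (Q : Set E) (x : E) : Set E :=
  {u | x ∈ Q ∧ ∀ y ∈ Q, inner ℝ u (y - x) ≤ 0}

/-- The projection onto `Q`: the point of `Q` nearest to `x` (for nonempty closed convex `Q` in a
Hilbert space it exists and is unique). -/
def proj (Q : Set E) (x : E) : E :=
  Classical.epsilon fun y => y ∈ Q ∧ ∀ z ∈ Q, ‖x - y‖ ≤ ‖x - z‖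

/-- The resolvent `J_A = (Id + A)⁻¹` of a set-valued operator: the point `y` such that
`x ∈ y + A y` (for maximally monotone `A` it exists and is unique). -/
def resolvent (A : E → Set E) (x : E) : E :=
  Classical.epsilon fun y => x - y ∈ A y

end Convex

/-- The function `φ = ι_{ℝ₋}`. -/
def phi : ℝ → EReal := indicatorFun (Iic (0 : ℝ))

section Operators

variable {H : Type*} [NormedAddCommGroup H] [InnerProductSpace ℝ H] {N : ℕ}

/-- The affine hyperplane `{p ∈ ℝ^N : ∑ i, p i = 1}`. -/
def P₁ (N : ℕ) : Set (EuclideanSpace ℝ (Fin N)) := {p | ∑ i, p i = 1}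

/-- `A₁ (x, p) = N_Q(x) × N_{P₁}(p)`. -/
def opA₁ (Q : Set H) (z : Space H N) : Set (Space H N) :=
  {w | w.fst ∈ normalCone Q z.fst ∧ w.snd ∈ normalCone (P₁ N) z.snd}

/-- `B_i (x, p) = (p_i ∂f_i(x)) × (∂φ*(p_i) e_i - f_i(x) e_i)`. -/
def opB (f : Fin N → H → ℝ) (i : Fin N) (z : Space H N) : Set (Space H N) :=
  {w | w.fst ∈ z.snd i • subdifferential (fun x => ((f i x : ℝ) : EReal)) z.fst ∧
    ∃ t ∈ subdifferential (conjugate phi) (z.snd i),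
      w.snd = t • EuclideanSpace.single i (1 : ℝ) - f i z.fst • EuclideanSpace.single i (1 : ℝ)}

/-- `C (x, p) = (∇h(x), 0)`. -/
def opC [CompleteSpace H] (h : H → ℝ) (z : Space H N) : Space H N :=
  WithLp.toLp 2 (gradient h z.fst, 0)

/-- The family `C_1 = C` and `C_i = 0` for the other indices. -/
def opCi [CompleteSpace H] (h : H → ℝ) (i : Fin N) (z : Space H N) : Space H N :=
  if (i : ℕ) = 0 then opC h z else 0

/-- `z = (x, p)` solves `0 ∈ A₁ z + ∑ i, B_i z + ∑ i, C_i z`. -/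
def IsSolution [CompleteSpace H] (Q : Set H) (h : H → ℝ) (f : Fin N → H → ℝ) (z : Space H N) :
    Prop :=
  (0 : Space H N) ∈ opA₁ Q z + ∑ i, opB f i z + {∑ i, opCi h i z}

/-- The distributed forward-backward routine. Here `zbar k j` is `(x̄_{j+1}^k, p̄_{j+1}^k)` for
`j = 0, …, N-1` and `z k j` is `(x_{j+1}^k, p_{j+1}^k)` for `j = 0, …, N`; likewise `opB f j` is
`B_{j+1}`. The starting point `zbar 0` is arbitrary. -/
structure IsDistributedFB [CompleteSpace H] (hN : 2 ≤ N) (Q : Set H) (h : H → ℝ)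
    (f : Fin N → H → ℝ) (lam γ : ℝ) (zbar : ℕ → Fin N → Space H N)
    (z : ℕ → Fin (N + 1) → Space H N) : Prop where
  proj_step : ∀ k, z k 0 =
    WithLp.toLp 2 (proj Q (zbar k ⟨0, by omega⟩).fst, proj (P₁ N) (zbar k ⟨0, by omega⟩).snd)
  first_step : ∀ k, z k ⟨1, by omega⟩ =
    resolvent (fun y => lam • opB f ⟨0, by omega⟩ y)
      (zbar k ⟨1, by omega⟩ + z k 0 - zbar k ⟨0, by omega⟩ - lam • opC h (z k 0))
  middle_step : ∀ k (i : ℕ) (_ : 1 ≤ i) (hi : i + 1 < N), z k ⟨i + 1, by omega⟩ =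
    resolvent (fun y => lam • opB f ⟨i, by omega⟩ y)
      (zbar k ⟨i + 1, hi⟩ + z k ⟨i, by omega⟩ - zbar k ⟨i, by omega⟩)
  last_step : ∀ k, z k ⟨N, by omega⟩ =
    resolvent (fun y => lam • opB f ⟨N - 1, by omega⟩ y)
      (z k 0 + z k ⟨N - 1, by omega⟩ - zbar k ⟨N - 1, by omega⟩)
  update : ∀ k (j : Fin N), zbar (k + 1) j = zbar k j + γ • (z k j.succ - z k j.castSucc)

end Operators

end

end DRO

/-! The routine is a ring splitting for the `N + 1` monotone operators `A₁, λB₁, …, λB_N` and the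
cocoercive map `D = λC`. The resolvent identities exhibit in each sweep an element `r_j`
(`residual`) of the `j`-th operator at `x_j`. These telescope, so their sum with `D x_0` equals `z_N
- x_N`, where `z` are the governing variables and `z_N = x_0`. If all `x_j` equal `w`, this says
exactly that `w` solves the inclusion.

Comparing a sweep with a stationary one `(ζ, w)`, adding the `N + 1` monotonicity inequalities and
summing by parts gives (`IsSweep.fejer`) that `∑ ‖z_j - ζ_j‖²` decreases by at least `κ (∑ ‖x_{j+1}
- x_j‖² + ‖D x_0 - D w‖²)`. Here `κ > 0` because a binary quadratic form is positive definite
precisely under the bound on `γ`. Hence the iterates are bounded, the differences `x_{j+1} - x_j`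
vanish, and `D x_0` converges strongly.

A Minty argument (`isSweep_of_weakTendsto`) shows that weak cluster points are stationary sweeps,
and an Opial argument that they share one limit of `x_0`.

The operator inputs are Baillon–Haddad for `∇h` and, for `B_i`, monotonicity together with
surjectivity of `Id + λB_i`. The latter reduces to a proximal problem for `max(0, b + λ f_i)² / 2`.
-/

namespace DRO

/-! ### Convex analysis: continuity, subgradients, proximal points -/

section ConvexAnalysis

variable {E : Type*} [NormedAddCommGroup E] [InnerProductSpace ℝ E]

/-- Stands in for one-sided derivatives: a variational inequality on a segment, divided by its
parameter `t`, has this form and passes to `t → 0`. -/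
theorem le_of_forall_le_add_mul {c d K : ℝ} (h : ∀ t : ℝ, 0 < t → t ≤ 1 → c ≤ d + t * K) :
    c ≤ d := by
  have h1 : Tendsto (fun t : ℝ => d + t * K) (𝓝[>] 0) (𝓝 d) := by
    have : Tendsto (fun t : ℝ => d + t * K) (𝓝 0) (𝓝 (d + 0 * K)) := by
      apply Continuous.tendsto; fun_prop
    simpa using this.mono_left nhdsWithin_le_nhds
  refine ge_of_tendsto h1 ?_
  filter_upwards [Ioc_mem_nhdsGT (zero_lt_one' ℝ)] with t ht using h t ht.1 ht.2

theorem convexOn_le_segment {g : E → ℝ} (hg : ConvexOn ℝ univ g) (x y : E) {t : ℝ} (h0 : 0 ≤ t)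
    (h1 : t ≤ 1) : g (x + t • (y - x)) ≤ g x + t * (g y - g x) := by
  have h := hg.2 (mem_univ x) (mem_univ y) (sub_nonneg.2 h1) h0 (by ring)
  have e : x + t • (y - x) = (1 - t) • x + t • y := by module
  rw [e]
  refine h.trans (le_of_eq ?_)
  simp only [smul_eq_mul]; ring

/-- A finite convex lower semicontinuous function on a Hilbert space is continuous. -/
theorem continuous_of_convexOn_of_lowerSemicontinuous [CompleteSpace E] {f : E → ℝ}
    (hf : ConvexOn ℝ univ f) (hlsc : LowerSemicontinuous f) : Continuous f := by
  -- Baire: the closed sets `{f ≤ n}` cover the space, so `f` is bounded above near some point,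
  -- which suffices for a convex function.
  obtain ⟨n, x, hx⟩ := nonempty_interior_of_iUnion_of_closed
    (f := fun n : ℕ => {x | f x ≤ n}) (fun n => hlsc.isClosed_preimage (n : ℝ)) (by
      refine eq_univ_of_forall fun x => ?_
      obtain ⟨n, hn⟩ := exists_nat_ge (f x)
      exact mem_iUnion.2 ⟨n, hn⟩)
  rw [← continuousOn_univ]
  have hb : (𝓝 x).IsBoundedUnder (· ≤ ·) f := by
    refine ⟨n, ?_⟩
    rw [eventually_map]
    exact mem_interior_iff_mem_nhds.1 hx
  exact ((hf.continuousOn_tfae isOpen_univ univ_nonempty).out 1 3).2 (by exact ⟨x, mem_univ x, hb⟩)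

/-- A finite continuous convex function on a Hilbert space has a subgradient everywhere. -/
theorem exists_subgradient [CompleteSpace E] {f : E → ℝ} (hf : ConvexOn ℝ univ f)
    (hc : Continuous f) (x : E) : ∃ u : E, ∀ y, f x + inner ℝ u (y - x) ≤ f y := by
  have hopen : IsOpen {p : E × ℝ | p.1 ∈ univ ∧ f p.1 < p.2} := by
    have : {p : E × ℝ | p.1 ∈ univ ∧ f p.1 < p.2} = {p : E × ℝ | f p.1 < p.2} := by
      ext; simp
    rw [this]
    exact isOpen_lt (hc.comp continuous_fst) continuous_snd
  obtain ⟨φ, hφ⟩ := geometric_hahn_banach_open_point (x := ((x, f x) : E × ℝ))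
    hf.convex_strict_epigraph hopen (by simp)
  have split : ∀ (y : E) (s : ℝ), φ (y, s) = φ (y, 0) + s * φ (0, 1) := by
    intro y s
    have : ((y, s) : E × ℝ) = (y, 0) + s • ((0 : E), (1 : ℝ)) := by simp
    rw [this, map_add, map_smul, smul_eq_mul]
  set c := φ (0, 1) with hcdef
  -- The hyperplane separating `(x, f x)` from the strict epigraph is not vertical; dividing by `-c`
  -- makes it the graph of an affine minorant.
  have hcneg : c < 0 := by
    have h := hφ (x, f x + 1) ⟨mem_univ _, by simp⟩
    rw [split x (f x + 1), split x (f x)] at h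
    linarith
  let ψ : E →L[ℝ] ℝ := φ.comp (ContinuousLinearMap.inl ℝ E ℝ)
  have hψ : ∀ y, ψ y = φ (y, 0) := fun y => rfl
  refine ⟨(-c)⁻¹ • (InnerProductSpace.toDual ℝ E).symm ψ, fun y => ?_⟩
  rw [inner_smul_left, InnerProductSpace.toDual_symm_apply, map_sub, hψ, hψ]
  have key : φ (y, 0) - φ (x, 0) ≤ -c * (f y - f x) := by
    refine le_of_forall_le_add_mul (K := -c) fun t ht _ => ?_
    have h := hφ (y, f y + t) ⟨mem_univ _, by simp [ht]⟩
    rw [split y (f y + t), split x (f x)] at h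
    nlinarith
  have h2 : (-c)⁻¹ * (φ (y, 0) - φ (x, 0)) ≤ f y - f x := by
    rw [inv_mul_le_iff₀ (by linarith)]; exact key
  simp only [RCLike.conj_to_real]
  linarith

/-- Nonnegative continuous convex functions have a proximal point, characterized by the
subgradient inequality. -/
theorem exists_prox [CompleteSpace E] {g : E → ℝ} (hg : ConvexOn ℝ univ g) (hc : Continuous g)
    (hnn : ∀ x, 0 ≤ g x) (a : E) : ∃ x : E, ∀ y, g x + inner ℝ (a - x) (y - x) ≤ g y := by
  let F : E → ℝ := fun x => ‖x - a‖ ^ 2 / 2 + g x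
  have hFc : Continuous F := by fun_prop
  have hbdd : BddBelow (range F) := ⟨0, by rintro _ ⟨x, rfl⟩; have := hnn x; positivity⟩
  set m := sInf (range F)
  have hm : ∀ x, m ≤ F x := fun x => csInf_le hbdd (mem_range_self x)
  have hex : ∀ n : ℕ, ∃ x, F x < m + 1 / ((n : ℝ) + 1) := by
    intro n
    obtain ⟨_, ⟨x, rfl⟩, hx⟩ := exists_lt_of_csInf_lt (range_nonempty F)
      (lt_add_of_pos_right m (by positivity : (0 : ℝ) < 1 / ((n : ℝ) + 1)))
    exact ⟨x, hx⟩
  choose u hu using hex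
  -- The parallelogram identity at the midpoint: near-minimizers of `F` are close together, so
  -- minimizing sequences are Cauchy.
  have hpar : ∀ x y, ‖x - y‖ ^ 2 ≤ 4 * ((F x - m) + (F y - m)) := by
    intro x y
    have h1 := hm (x + (1 / 2 : ℝ) • (y - x))
    have h2 := convexOn_le_segment hg x y (t := 1 / 2) (by norm_num) (by norm_num)
    have h3 : ‖x + (1 / 2 : ℝ) • (y - x) - a‖ ^ 2
        = ‖x - a‖ ^ 2 / 2 + ‖y - a‖ ^ 2 / 2 - ‖x - y‖ ^ 2 / 4 := by
      have e1 : x + (1 / 2 : ℝ) • (y - x) - a = (1 / 2 : ℝ) • ((x - a) + (y - a)) := by module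
      have e2 : x - y = (x - a) - (y - a) := by abel
      rw [e1, e2, norm_smul, mul_pow, norm_add_sq_real, norm_sub_sq_real (x - a) (y - a)]
      norm_num; ring
    simp only [F] at h1 ⊢
    rw [h3] at h1
    linarith
  have hcau : CauchySeq u := by
    refine Metric.cauchySeq_iff'.2 fun ε hε => ?_
    obtain ⟨n, hn⟩ := exists_nat_one_div_lt (show (0 : ℝ) < ε ^ 2 / 8 by positivity)
    refine ⟨n, fun k hk => ?_⟩
    have h1 := hpar (u k) (u n)
    have h2 := hu k
    have h3 := hu n
    have h4 : 1 / ((k : ℝ) + 1) ≤ 1 / ((n : ℝ) + 1) := by gcongr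
    rw [dist_eq_norm]
    exact lt_of_pow_lt_pow_left₀ 2 hε.le (by linarith)
  obtain ⟨x, hx⟩ := cauchySeq_tendsto_of_complete hcau
  have hFx : F x ≤ m := by
    have h1 : Tendsto (fun n => F (u n)) atTop (𝓝 (F x)) := (hFc.tendsto x).comp hx
    have h2 : Tendsto (fun n : ℕ => m + 1 / ((n : ℝ) + 1)) atTop (𝓝 (m + 0)) :=
      tendsto_const_nhds.add tendsto_one_div_add_atTop_nhds_zero_nat
    simpa using le_of_tendsto_of_tendsto' h1 h2 fun n => (hu n).le
  refine ⟨x, fun y => ?_⟩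
  have key : g x - g y + inner ℝ (a - x) (y - x) ≤ 0 := by
    refine le_of_forall_le_add_mul (K := ‖y - x‖ ^ 2 / 2) fun t h0 h1 => ?_
    have h2 := hFx.trans (hm (x + t • (y - x)))
    have h3 := convexOn_le_segment hg x y h0.le h1
    have h4 : ‖x + t • (y - x) - a‖ ^ 2
        = ‖x - a‖ ^ 2 - 2 * t * inner ℝ (a - x) (y - x) + t ^ 2 * ‖y - x‖ ^ 2 := by
      have e1 : x + t • (y - x) - a = (x - a) + t • (y - x) := by module
      have e2 : a - x = -(x - a) := by abel
      rw [e1, norm_add_sq_real, inner_smul_right, norm_smul, e2, inner_neg_left, mul_pow,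
        Real.norm_eq_abs, sq_abs]
      ring
    simp only [F] at h2
    rw [h4] at h2
    have h5 : t * (g x - g y + inner ℝ (a - x) (y - x)) ≤ t * (t * (‖y - x‖ ^ 2 / 2)) := by
      nlinarith
    have := le_of_mul_le_mul_left h5 h0
    linarith
  linarith

/-! ### Convex functions with Lipschitz gradient -/

section Smooth

variable [CompleteSpace E] {h : E → ℝ}

theorem hasDerivAt_comp_line (hd : Differentiable ℝ h) (x v : E) (t : ℝ) :
    HasDerivAt (fun s : ℝ => h (x + s • v)) (inner ℝ (gradient h (x + t • v)) v) t := by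
  have h1 : HasFDerivAt h _ (x + t • v) :=
    hasGradientAt_iff_hasFDerivAt.1 (hd (x + t • v)).hasGradientAt
  have h2 : HasDerivAt (fun s : ℝ => x + s • v) v t := by
    simpa using ((hasDerivAt_id t).smul_const v).const_add x
  have h3 := h1.comp_hasDerivAt t h2
  rwa [InnerProductSpace.toDual_apply_apply] at h3

theorem gradient_inequality (hconv : ConvexOn ℝ univ h) (hd : Differentiable ℝ h) (x y : E) :
    h x + inner ℝ (gradient h x) (y - x) ≤ h y := by
  have h1 := hasDerivAt_comp_line hd x (y - x) 0
  rw [zero_smul, add_zero, hasDerivAt_iff_tendsto_slope_zero] at h1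
  have h2 : inner ℝ (gradient h x) (y - x) ≤ h y - h x := by
    have h2 : 𝓝[>] (0 : ℝ) ≤ 𝓝[≠] 0 := nhdsWithin_mono 0 fun t (ht : 0 < t) => ht.ne'
    refine le_of_tendsto (h1.mono_left h2) ?_
    filter_upwards [Ioc_mem_nhdsGT (zero_lt_one' ℝ)] with t ht
    have h3 := convexOn_le_segment hconv x y ht.1.le ht.2
    rw [smul_eq_mul, inv_mul_le_iff₀ ht.1, zero_add, zero_smul, add_zero]
    linarith
  linarith

theorem descent_inequality (hd : Differentiable ℝ h) {L : ℝ}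
    (hlip : ∀ x y, ‖gradient h x - gradient h y‖ ≤ L * ‖x - y‖) (x v : E) :
    h (x + v) ≤ h x + inner ℝ (gradient h x) v + L / 2 * ‖v‖ ^ 2 := by
  let φ : ℝ → ℝ := fun t => h (x + t • v) - t * inner ℝ (gradient h x) v - L / 2 * t ^ 2 * ‖v‖ ^ 2
  have hφ : ∀ t, HasDerivAt φ (inner ℝ (gradient h (x + t • v)) v - inner ℝ (gradient h x) v
      - L * t * ‖v‖ ^ 2) t := by
    intro t
    have h1 := ((hasDerivAt_comp_line hd x v t).sub
      ((hasDerivAt_id t).mul_const (inner ℝ (gradient h x) v))).sub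
      ((((hasDerivAt_id t).pow 2).const_mul (L / 2)).mul_const (‖v‖ ^ 2))
    refine h1.congr_deriv ?_
    simp only [id, one_mul, Nat.cast_ofNat]
    ring
  have hanti : AntitoneOn φ (Icc 0 1) := by
    refine antitoneOn_of_deriv_nonpos (convex_Icc 0 1)
      (fun t _ => (hφ t).continuousAt.continuousWithinAt)
      (fun t _ => (hφ t).differentiableAt.differentiableWithinAt) fun t ht => ?_
    rw [interior_Icc] at ht
    rw [(hφ t).deriv, ← inner_sub_left]
    have h1 := real_inner_le_norm (gradient h (x + t • v) - gradient h x) v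
    have h2 := hlip (x + t • v) x
    rw [add_sub_cancel_left, norm_smul, Real.norm_of_nonneg ht.1.le] at h2
    nlinarith [norm_nonneg v]
  have := hanti (left_mem_Icc.2 zero_le_one) (right_mem_Icc.2 zero_le_one) zero_le_one
  simp only [φ, one_smul, zero_smul, add_zero] at this
  linarith

/-- The Baillon-Haddad theorem. -/
theorem cocoercive_gradient (hconv : ConvexOn ℝ univ h) (hd : Differentiable ℝ h) {β : ℝ}
    (hβ : 0 < β) (hlip : ∀ x y, ‖gradient h x - gradient h y‖ ≤ β⁻¹ * ‖x - y‖) (x y : E) :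
    β * ‖gradient h x - gradient h y‖ ^ 2 ≤ inner ℝ (x - y) (gradient h x - gradient h y) := by
  -- Compare the descent bound at `y` with the tangent bound at `x`, both at the point `y - β g`,
  -- which minimizes the difference of the two models. Adding the result to its copy with `x`, `y`
  -- exchanged gives cocoercivity.
  have key : ∀ x y, h x + inner ℝ (gradient h x) (y - x)
      + β / 2 * ‖gradient h y - gradient h x‖ ^ 2 ≤ h y := by
    intro x y
    set g := gradient h y - gradient h x with hg
    have h1 := descent_inequality hd hlip y (-(β • g))
    have h2 := gradient_inequality hconv hd x (y + -(β • g))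
    have h3 : inner ℝ (gradient h y) g - inner ℝ (gradient h x) g = ‖g‖ ^ 2 := by
      rw [← inner_sub_left, ← hg, real_inner_self_eq_norm_sq]
    have e : y + -(β • g) - x = (y - x) - β • g := by abel
    rw [e, inner_sub_right, inner_smul_right] at h2
    rw [inner_neg_right, inner_smul_right, norm_neg, norm_smul, Real.norm_of_nonneg hβ.le,
      mul_pow] at h1
    have h4 : β⁻¹ / 2 * (β ^ 2 * ‖g‖ ^ 2) = β / 2 * ‖g‖ ^ 2 := by field_simp
    rw [h4] at h1
    nlinarith
  have h1 := key x y
  have h2 := key y x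
  rw [norm_sub_rev] at h1
  have h3 : inner ℝ (x - y) (gradient h x - gradient h y)
      = - inner ℝ (gradient h x) (y - x) - inner ℝ (gradient h y) (x - y) := by
    rw [real_inner_comm, inner_sub_left, ← neg_sub x y, inner_neg_right]; ring
  rw [h3]
  linarith

end Smooth

end ConvexAnalysis

/-! ### Monotonicity and resolvents of the operators -/

section Operators

/-- Surjectivity of `Id + A`. -/
def IsSurjResolvent {E : Type*} [NormedAddCommGroup E] (A : E → Set E) : Prop :=
  ∀ x, ∃ y, x - y ∈ A y

theorem sub_resolvent_mem {E : Type*} [NormedAddCommGroup E] {A : E → Set E}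
    (hA : IsSurjResolvent A) (x : E) :
    x - resolvent A x ∈ A (resolvent A x) :=
  Classical.epsilon_spec (hA x)

variable {E : Type*} [NormedAddCommGroup E] [InnerProductSpace ℝ E]

/-- Monotonicity of a set-valued operator. -/
def IsMonotoneOp (A : E → Set E) : Prop :=
  ∀ x y u v, u ∈ A x → v ∈ A y → 0 ≤ (inner ℝ (x - y) (u - v) : ℝ)

theorem proj_spec [CompleteSpace E] {Q : Set E} (hne : Q.Nonempty) (hconv : Convex ℝ Q)
    (hcl : IsClosed Q) (x : E) :
    proj Q x ∈ Q ∧ ∀ z ∈ Q, ‖x - proj Q x‖ ≤ ‖x - z‖ := by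
  refine Classical.epsilon_spec (p := fun y => y ∈ Q ∧ ∀ z ∈ Q, ‖x - y‖ ≤ ‖x - z‖) ?_
  obtain ⟨v, hv, he⟩ := exists_norm_eq_iInf_of_complete_convex hne hcl.isComplete hconv x
  refine ⟨v, hv, fun z hz => he.trans_le ?_⟩
  exact ciInf_le (f := fun w : Q => ‖x - w‖) ⟨0, forall_mem_range.2 fun _ => norm_nonneg _⟩ ⟨z, hz⟩

theorem sub_proj_mem_normalCone [CompleteSpace E] {Q : Set E} (hne : Q.Nonempty)
    (hconv : Convex ℝ Q) (hcl : IsClosed Q) (x : E) : x - proj Q x ∈ normalCone Q (proj Q x) := by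
  obtain ⟨hm, hmin⟩ := proj_spec hne hconv hcl x
  refine ⟨hm, (norm_eq_iInf_iff_real_inner_le_zero hconv hm).1 (le_antisymm ?_ ?_)⟩
  · have := hne.to_subtype
    exact le_ciInf fun w => hmin w w.2
  · exact ciInf_le (f := fun w : Q => ‖x - w‖)
      ⟨0, forall_mem_range.2 fun _ => norm_nonneg _⟩ ⟨_, hm⟩

theorem isMonotoneOp_normalCone (Q : Set E) : IsMonotoneOp (normalCone Q) := by
  rintro x y u v ⟨hx, hu⟩ ⟨hy, hv⟩
  have h1 := hu y hy
  have h2 := hv x hx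
  rw [← neg_sub x y, inner_neg_right] at h1
  rw [real_inner_comm, inner_sub_left]
  linarith

theorem smul_mem_normalCone {Q : Set E} {x u : E} (hu : u ∈ normalCone Q x) {c : ℝ} (hc : 0 ≤ c) :
    c • u ∈ normalCone Q x := by
  refine ⟨hu.1, fun y hy => ?_⟩
  rw [inner_smul_left]
  exact mul_nonpos_of_nonneg_of_nonpos hc (hu.2 y hy)

theorem IsMonotoneOp.smul {A : E → Set E} (hA : IsMonotoneOp A) {c : ℝ} (hc : 0 ≤ c) :
    IsMonotoneOp fun x => c • A x := by
  rintro x y _ _ ⟨u, hu, rfl⟩ ⟨v, hv, rfl⟩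
  simp only
  rw [← smul_sub, inner_smul_right]
  exact mul_nonneg hc (hA x y u v hu hv)

theorem mem_subdifferential_coe {f : E → ℝ} {x u : E} :
    u ∈ subdifferential (fun x => ((f x : ℝ) : EReal)) x ↔
      ∀ y, f x + inner ℝ u (y - x) ≤ f y := by
  simp only [subdifferential, mem_ofPred_eq]
  exact forall_congr' fun y => by exact_mod_cast Iff.rfl

theorem conjugate_phi_of_nonneg {u : ℝ} (hu : 0 ≤ u) : conjugate phi u = 0 := by
  refine le_antisymm (iSup_le fun x => ?_) (le_iSup_of_le 0 ?_)
  · by_cases hx : x ≤ 0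
    · simp only [phi, indicatorFun, mem_Iic, hx, if_true, sub_zero]
      exact_mod_cast (by simpa using mul_nonpos_of_nonneg_of_nonpos hu hx :
        (inner ℝ x u : ℝ) ≤ 0)
    · simp [phi, indicatorFun, hx]
  · simp [phi, indicatorFun]

theorem conjugate_phi_of_neg {u : ℝ} (hu : u < 0) : conjugate phi u = ⊤ := by
  refine EReal.eq_top_iff_forall_lt _ |>.2 fun r => ?_
  -- This point is feasible for `φ`, and its product with `u` is `|r| + 1 > r`.
  have hx : (|r| + 1) / u ≤ 0 := div_nonpos_of_nonneg_of_nonpos (by positivity) hu.le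
  refine lt_of_lt_of_le ?_ (le_iSup _ ((|r| + 1) / u))
  simp only [phi, indicatorFun, mem_Iic, hx, if_true, sub_zero]
  have : (inner ℝ ((|r| + 1) / u) u : ℝ) = |r| + 1 := by
    simp; field_simp [hu.ne]
  rw [this]
  exact_mod_cast (le_abs_self r).trans_lt (lt_add_one _)

theorem mem_subdifferential_conjugate_phi {p t : ℝ} :
    t ∈ subdifferential (conjugate phi) p ↔ 0 ≤ p ∧ t ≤ 0 ∧ t * p = 0 := by
  simp only [subdifferential, mem_ofPred_eq]
  constructor
  · intro h
    have hp : 0 ≤ p := by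
      by_contra! hp
      have := h 0
      rw [conjugate_phi_of_neg hp, conjugate_phi_of_nonneg le_rfl] at this
      rw [EReal.top_add_coe] at this
      exact absurd this (by simp)
    have h' : ∀ y : ℝ, 0 ≤ y → t * (y - p) ≤ 0 := by
      intro y hy
      have := h y
      rw [conjugate_phi_of_nonneg hp, conjugate_phi_of_nonneg hy, zero_add] at this
      have h2 : (inner ℝ t (y - p) : ℝ) ≤ 0 := by exact_mod_cast this
      simpa [mul_comm] using h2
    -- The test points `0`, `p + 1`, `2p` give `t p ≥ 0`, `t ≤ 0`, `t p ≤ 0` respectively.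
    have h0 := h' 0 le_rfl
    have h1 := h' (p + 1) (by linarith)
    have h2 := h' (2 * p) (by linarith)
    exact ⟨hp, by linarith, by linarith⟩
  · rintro ⟨hp, ht, htp⟩ y
    rw [conjugate_phi_of_nonneg hp, zero_add]
    rcases lt_or_ge y 0 with hy | hy
    · rw [conjugate_phi_of_neg hy]; exact le_top
    · rw [conjugate_phi_of_nonneg hy]
      have h2 : (inner ℝ t (y - p) : ℝ) ≤ 0 := by
        simp only [RCLike.inner_apply, conj_trivial]
        nlinarith
      exact_mod_cast h2

theorem P₁_nonempty {N : ℕ} (hN : 0 < N) : (P₁ N).Nonempty :=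
  ⟨EuclideanSpace.single ⟨0, hN⟩ 1, by simp [P₁]⟩

theorem convex_P₁ (N : ℕ) : Convex ℝ (P₁ N) := by
  intro x hx y hy a b _ _ hab
  simp only [P₁, mem_ofPred_eq] at hx hy ⊢
  simp [Finset.sum_add_distrib, ← Finset.mul_sum, hx, hy, hab]

theorem isClosed_P₁ (N : ℕ) : IsClosed (P₁ N) :=
  isClosed_eq (by fun_prop) continuous_const

variable {H : Type*} [NormedAddCommGroup H] [InnerProductSpace ℝ H] {N : ℕ}

theorem isMonotoneOp_opA₁ (Q : Set H) : IsMonotoneOp (opA₁ (N := N) Q) := by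
  rintro x y u v ⟨hu1, hu2⟩ ⟨hv1, hv2⟩
  rw [WithLp.prod_inner_apply]
  exact add_nonneg (isMonotoneOp_normalCone Q _ _ _ _ hu1 hv1)
    (isMonotoneOp_normalCone (P₁ N) _ _ _ _ hu2 hv2)

/-- Normal cones are cones; this is why the routine projects with no step size while the other
operators carry `λ`. -/
theorem smul_opA₁ (Q : Set H) {c : ℝ} (hc : 0 < c) (x : Space H N) : c • opA₁ Q x = opA₁ Q x := by
  have h : ∀ {c : ℝ}, 0 < c → ∀ u ∈ opA₁ Q x, c • u ∈ opA₁ Q x := fun hc u hu =>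
    ⟨smul_mem_normalCone hu.1 hc.le, smul_mem_normalCone hu.2 hc.le⟩
  ext u
  constructor
  · rintro ⟨v, hv, rfl⟩
    exact h hc v hv
  · intro hu
    exact ⟨c⁻¹ • u, h (inv_pos.2 hc) u hu, smul_inv_smul₀ hc.ne' u⟩

theorem sub_proj_mem_opA₁ [CompleteSpace H] (hN : 0 < N) {Q : Set H} (hne : Q.Nonempty)
    (hconv : Convex ℝ Q) (hcl : IsClosed Q) (x : Space H N) :
    x - WithLp.toLp 2 (proj Q x.fst, proj (P₁ N) x.snd) ∈
      opA₁ Q (WithLp.toLp 2 (proj Q x.fst, proj (P₁ N) x.snd)) :=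
  ⟨sub_proj_mem_normalCone hne hconv hcl x.fst,
    sub_proj_mem_normalCone (P₁_nonempty hN) (convex_P₁ N) (isClosed_P₁ N) x.snd⟩

/-- Saddle structure: weighting the two subgradient inequalities by `p_i, q_i ≥ 0` bounds the first
component below by `(p_i - q_i)(f_i(x) - f_i(y))`, which the second component cancels. By
complementarity, `-t q_i - s p_i ≥ 0` remains. -/
theorem isMonotoneOp_opB (f : Fin N → H → ℝ) (i : Fin N) : IsMonotoneOp (opB f i) := by
  rintro x y w w' ⟨⟨u, hu, hwu⟩, t, ht, hw⟩ ⟨⟨v, hv, hwv⟩, s, hs, hw'⟩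
  rw [WithLp.prod_inner_apply]
  have e1 : (w - w').fst = x.snd i • u - y.snd i • v := by
    rw [WithLp.sub_fst, ← hwu, ← hwv]
  have e2 : (w - w').snd = ((t - f i x.fst) - (s - f i y.fst)) • EuclideanSpace.single i (1 : ℝ) := by
    rw [WithLp.sub_snd, hw, hw']; module
  rw [mem_subdifferential_coe] at hu hv
  obtain ⟨hp, ht0, htp⟩ := mem_subdifferential_conjugate_phi.1 ht
  obtain ⟨hq, hs0, hsq⟩ := mem_subdifferential_conjugate_phi.1 hs
  have h1 := hu y.fst
  have h2 := hv x.fst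
  rw [← neg_sub x.fst y.fst, inner_neg_right, real_inner_comm] at h1
  rw [real_inner_comm] at h2
  have e3 : inner ℝ (x - y).snd (w - w').snd
      = (x.snd i - y.snd i) * ((t - f i x.fst) - (s - f i y.fst)) := by
    rw [e2, inner_smul_right, EuclideanSpace.inner_single_right]
    simp; ring
  have e4 : inner ℝ (x - y).fst (w - w').fst
      = x.snd i * inner ℝ (x.fst - y.fst) u - y.snd i * inner ℝ (x.fst - y.fst) v := by
    rw [e1, inner_sub_right, inner_smul_right, inner_smul_right, WithLp.sub_fst]
  change 0 ≤ inner ℝ (x - y).fst (w - w').fst + inner ℝ (x - y).snd (w - w').snd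
  rw [e3, e4]
  nlinarith [mul_le_mul_of_nonneg_left h1 hp, mul_le_mul_of_nonneg_left h2 hq,
    mul_nonneg hp (neg_nonneg.2 hs0), mul_nonneg hq (neg_nonneg.2 ht0)]

/-- Descent inequality for `s ↦ max(0, s)² / 2`, whose derivative `max(0, s)` is 1-Lipschitz. It
replaces a chain rule for the subdifferential. -/
theorem half_max_sq_add_le (s q : ℝ) :
    max 0 (s + q) ^ 2 / 2 ≤ max 0 s ^ 2 / 2 + max 0 s * q + q ^ 2 / 2 := by
  rcases max_cases 0 (s + q) with ⟨h1, h2⟩ | ⟨h1, h2⟩ <;>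
  rcases max_cases 0 s with ⟨h3, h4⟩ | ⟨h3, h4⟩ <;> rw [h1, h3] <;>
  nlinarith [sq_nonneg (s + q), sq_nonneg q, sq_nonneg s]

/-- The joint proximal system defining the resolvent of `opB`. -/
theorem exists_saddle_prox [CompleteSpace H] {f : H → ℝ} (hf : ConvexOn ℝ univ f)
    (hlsc : LowerSemicontinuous f) {c : ℝ} (hc : 0 < c) (a : H) (b : ℝ) :
    ∃ x u, (∀ y, f x + inner ℝ u (y - x) ≤ f y) ∧ a - x = c • max 0 (b + c * f x) • u := by
  have hcont := continuous_of_convexOn_of_lowerSemicontinuous hf hlsc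
  have haff : ConvexOn ℝ univ fun x => b + c * f x := by
    have := (hf.smul hc.le).add_const b
    refine this.congr fun x _ => ?_
    simp [add_comm]
  have hmax : ConvexOn ℝ univ fun x => max 0 (b + c * f x) :=
    (convexOn_const 0 convex_univ).sup haff
  have hg : ConvexOn ℝ univ fun x => max 0 (b + c * f x) ^ 2 / 2 := by
    have := (hmax.pow (fun x _ => le_max_left _ _) 2).smul (by norm_num : (0 : ℝ) ≤ 1 / 2)
    refine this.congr fun x _ => ?_
    simp; ring
  -- Eliminating the dual variable forces `p = max(0, b + c f(x))`, and `c p ∂f(x)` is the expected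
  -- subdifferential of the function minimized here.
  obtain ⟨x, hx⟩ := exists_prox hg (by fun_prop) (fun x => by positivity) a
  -- Needed when `p = 0`: then `a = x`, yet some subgradient must still be supplied for the product
  -- `0 • ∂f(x)`.
  obtain ⟨u₀, hu₀⟩ := exists_subgradient hf hcont x
  set p := max 0 (b + c * f x) with hp
  have hp0 : 0 ≤ p := le_max_left _ _
  have key : ∀ y, inner ℝ (a - x) (y - x) ≤ p * (c * (f y - f x)) := by
    intro y
    refine le_of_forall_le_add_mul (K := (c * (f y - f x)) ^ 2 / 2) fun t h0 h1 => ?_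
    have h2 := hx (x + t • (y - x))
    rw [add_sub_cancel_left, inner_smul_right] at h2
    have h3 := convexOn_le_segment hf x y h0.le h1
    have h4 : max 0 (b + c * f (x + t • (y - x)))
        ≤ max 0 ((b + c * f x) + t * (c * (f y - f x))) := by
      refine max_le_max le_rfl ?_
      nlinarith
    have h5 : max 0 (b + c * f (x + t • (y - x))) ^ 2
        ≤ max 0 ((b + c * f x) + t * (c * (f y - f x))) ^ 2 :=
      pow_le_pow_left₀ (le_max_left _ _) h4 2
    have h6 := half_max_sq_add_le (b + c * f x) (t * (c * (f y - f x)))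
    rw [← hp] at h6
    refine le_of_mul_le_mul_left ?_ h0
    nlinarith
  rcases hp0.eq_or_lt with h0 | hpos
  · refine ⟨x, u₀, hu₀, ?_⟩
    have h1 := key a
    rw [← h0, zero_mul, real_inner_self_eq_norm_sq] at h1
    have h2 : a - x = 0 := by
      rw [← norm_eq_zero]
      exact pow_eq_zero_iff two_ne_zero |>.1 (le_antisymm h1 (sq_nonneg _))
    rw [← hp, ← h0, h2, zero_smul, smul_zero]
  · refine ⟨x, (c * p)⁻¹ • (a - x), fun y => ?_, ?_⟩
    · have h1 : (c * p)⁻¹ * inner ℝ (a - x) (y - x) ≤ f y - f x := by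
        rw [inv_mul_le_iff₀ (by positivity)]
        linarith [key y]
      rw [inner_smul_left]
      simp only [RCLike.conj_to_real]
      linarith
    · rw [← hp, smul_smul, smul_smul, mul_inv_cancel₀ (by positivity), one_smul]

theorem isSurjResolvent_smul_opB [CompleteSpace H] (f : Fin N → H → ℝ) (i : Fin N)
    (hf : ConvexOn ℝ univ (f i)) (hlsc : LowerSemicontinuous (f i)) {c : ℝ} (hc : 0 < c) :
    IsSurjResolvent fun x : Space H N => c • opB f i x := by
  intro z
  obtain ⟨x, u, hu, hxu⟩ := exists_saddle_prox hf hlsc hc z.fst (z.snd i)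
  set p := max 0 (z.snd i + c * f i x) with hp
  have hp0 : 0 ≤ p := le_max_left _ _
  -- Only coordinate `i` moves. Below, `t` is read off from `z_i - p = c (t - f_i(x))`, and the max
  -- formula for `p` yields its complementarity.
  let q : EuclideanSpace ℝ (Fin N) := z.snd + (p - z.snd i) • EuclideanSpace.single i (1 : ℝ)
  have hqi : q i = p := by simp [q]
  let t : ℝ := c⁻¹ * (z.snd i - p) + f i x
  have hct : c * t = z.snd i + c * f i x - p := by simp only [t]; field_simp; ring
  refine ⟨WithLp.toLp 2 (x, q), WithLp.toLp 2 (p • u, t • EuclideanSpace.single i (1 : ℝ)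
    - f i x • EuclideanSpace.single i (1 : ℝ)), ⟨?_, t, ?_, rfl⟩, ?_⟩
  · change p • u ∈ q i • _
    rw [hqi]
    exact smul_mem_smul_set (mem_subdifferential_coe.2 hu)
  · change t ∈ subdifferential (conjugate phi) (q i)
    rw [hqi, mem_subdifferential_conjugate_phi]
    have hle : z.snd i + c * f i x ≤ p := le_max_right _ _
    refine ⟨hp0, by nlinarith, ?_⟩
    have : c * (t * p) = 0 := by
      rw [← mul_assoc, hct]
      rcases max_cases 0 (z.snd i + c * f i x) with ⟨h1, h2⟩ | ⟨h1, h2⟩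
      · rw [hp, h1, mul_zero]
      · rw [hp, h1, sub_self, zero_mul]
    exact (mul_eq_zero.1 this).resolve_left hc.ne'
  · refine WithLp.ofLp_injective 2 (Prod.ext ?_ ?_)
    · exact hxu.symm
    · change c • (t • EuclideanSpace.single i (1 : ℝ) - f i x • EuclideanSpace.single i (1 : ℝ))
        = z.snd - q
      rw [← sub_smul, smul_smul, mul_sub, hct]
      simp only [q]
      module

end Operators

/-! ### Weak convergence along filters -/

section WeakConvergence

variable {E ι : Type*} [NormedAddCommGroup E] [InnerProductSpace ℝ E]

/-- Weak convergence, tested against inner products. -/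
def WeakTendsto (x : ι → E) (F : Filter ι) (w : E) : Prop :=
  ∀ v, Tendsto (fun k => (inner ℝ (x k) v : ℝ)) F (𝓝 (inner ℝ w v))

theorem WeakTendsto.add {x y : ι → E} {F : Filter ι} {v w : E} (hx : WeakTendsto x F v)
    (hy : WeakTendsto y F w) : WeakTendsto (fun k => x k + y k) F (v + w) := fun u => by
  simp only [inner_add_left]; exact (hx u).add (hy u)

theorem WeakTendsto.sub {x y : ι → E} {F : Filter ι} {v w : E} (hx : WeakTendsto x F v)
    (hy : WeakTendsto y F w) : WeakTendsto (fun k => x k - y k) F (v - w) := fun u => by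
  simp only [inner_sub_left]; exact (hx u).sub (hy u)

theorem weakTendsto_of_tendsto {x : ι → E} {F : Filter ι} {w : E} (hx : Tendsto x F (𝓝 w)) :
    WeakTendsto x F w := fun _ => hx.inner tendsto_const_nhds

/-- Boundedness is an explicit hypothesis since along a general filter weak convergence does not
provide it. -/
theorem tendsto_inner_zero_of_norm_le {x y : ι → E} {F : Filter ι} {C : ℝ}
    (hx : ∀ k, ‖x k‖ ≤ C) (hy : Tendsto y F (𝓝 0)) :
    Tendsto (fun k => (inner ℝ (x k) (y k) : ℝ)) F (𝓝 0) := by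
  refine squeeze_zero_norm (a := fun k => C * ‖y k‖) (fun k => ?_) ?_
  · exact (norm_inner_le_norm _ _).trans (mul_le_mul_of_nonneg_right (hx k) (norm_nonneg _))
  · simpa using hy.norm.const_mul C

theorem WeakTendsto.inner {x y : ι → E} {F : Filter ι} {w v : E} (hx : WeakTendsto x F w) {C : ℝ}
    (hC : ∀ k, ‖x k‖ ≤ C) (hy : Tendsto y F (𝓝 v)) :
    Tendsto (fun k => (inner ℝ (x k) (y k) : ℝ)) F (𝓝 (inner ℝ w v)) := by
  have h1 : Tendsto (fun k => y k - v) F (𝓝 0) := by simpa using hy.sub_const v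
  have h2 := (hx v).add (tendsto_inner_zero_of_norm_le hC h1)
  rw [add_zero] at h2
  refine h2.congr fun k => ?_
  rw [← inner_add_right, add_sub_cancel]

/-- Bounded families in a Hilbert space converge weakly along every ultrafilter. -/
theorem exists_weakTendsto_ultrafilter [CompleteSpace E] (U : Ultrafilter ι) {x : ι → E} {C : ℝ}
    (hC : ∀ k, ‖x k‖ ≤ C) : ∃ w, WeakTendsto x U w := by
  have hlim : ∀ v, ∃ l : ℝ, |l| ≤ C * ‖v‖ ∧ Tendsto (fun k => (inner ℝ (x k) v : ℝ)) U (𝓝 l) := by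
    intro v
    have hmem : ∀ k, (inner ℝ (x k) v : ℝ) ∈ Icc (-(C * ‖v‖)) (C * ‖v‖) := fun k =>
      abs_le.1 ((abs_real_inner_le_norm _ _).trans
        (mul_le_mul_of_nonneg_right (hC k) (norm_nonneg _)))
    obtain ⟨l, hl, hle⟩ := (isCompact_Icc (a := -(C * ‖v‖)) (b := C * ‖v‖)).ultrafilter_le_nhds
      (U.map fun k => (inner ℝ (x k) v : ℝ))
      (le_principal_iff.2 (Filter.mem_map.2 (univ_mem' hmem)))
    exact ⟨l, abs_le.2 hl, hle⟩
  choose l hlb hl using hlim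
  -- The limits of the inner products form a bounded linear functional, which the Riesz theorem
  -- represents by the weak limit.
  let L : E →ₗ[ℝ] ℝ :=
    { toFun := l
      map_add' := fun u v => tendsto_nhds_unique (hl (u + v)) (by
        simpa only [inner_add_right] using (hl u).add (hl v))
      map_smul' := fun c v => tendsto_nhds_unique (hl (c • v)) (by
        simpa only [inner_smul_right, RingHom.id_apply, smul_eq_mul] using (hl v).const_mul c) }
  refine ⟨(InnerProductSpace.toDual ℝ E).symm (L.mkContinuous C hlb), fun v => ?_⟩
  rw [InnerProductSpace.toDual_symm_apply]
  exact hl v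

theorem tendsto_toWeakSpace_of_weakTendsto [CompleteSpace E] {x : ι → E} {F : Filter ι} {w : E}
    (h : WeakTendsto x F w) :
    Tendsto (fun k => toWeakSpace ℝ E (x k)) F (𝓝 (toWeakSpace ℝ E w)) := by
  refine (WeakBilin.tendsto_iff_forall_eval_tendsto (topDualPairing ℝ E).flip ?_).2 fun φ => ?_
  · intro u v huv
    refine ext_inner_left ℝ fun t => ?_
    exact DFunLike.congr_fun huv (InnerProductSpace.toDual ℝ E t)
  · have hφ : ∀ v, (inner ℝ v ((InnerProductSpace.toDual ℝ E).symm φ) : ℝ) = φ v := fun v => by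
      rw [real_inner_comm, InnerProductSpace.toDual_symm_apply]
    have := h ((InnerProductSpace.toDual ℝ E).symm φ)
    simp only [hφ] at this
    exact this

end WeakConvergence

/-! ### The ring iteration and its Fejér inequality -/

section Ring

variable {E : Type*} [NormedAddCommGroup E] [InnerProductSpace ℝ E]

/-- The elements of the operators produced by one sweep of the ring iteration. -/
def residual (D : E → E) (z x : ℕ → E) : ℕ → E
  | 0 => z 0 - x 0
  | j + 1 => (z (j + 1) - x (j + 1)) - (z j - x j) - if j = 0 then D (x 0) else 0

/-- One sweep of the ring iteration: `z` are the governing variables and `x` the resolvents. The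
closing condition `z N = x 0` makes the last step uniform with the others. -/
structure IsSweep (A : ℕ → E → Set E) (D : E → E) (N : ℕ) (z x : ℕ → E) : Prop where
  mem : ∀ j ≤ N, residual D z x j ∈ A j (x j)
  closing : z N = x 0

/-- Abel summation, meant for `q j = z j - x j`. The forward term sits in the residual of index 1,
so it pairs with `y 1`, not `y 0`. -/
theorem sum_inner_residual_aux (y q : ℕ → E) (c : E) (n : ℕ) :
    (inner ℝ (y 0) (q 0) : ℝ) + ∑ j ∈ Finset.range (n + 1),
        inner ℝ (y (j + 1)) (q (j + 1) - q j - if j = 0 then c else 0) =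
      ∑ j ∈ Finset.range (n + 1), inner ℝ (y j - y (j + 1)) (q j)
        + inner ℝ (y (n + 1)) (q (n + 1)) - inner ℝ (y 1) c := by
  induction n with
  | zero => simp [inner_sub_right, inner_sub_left]; ring
  | succ n ih =>
    rw [Finset.sum_range_succ, ← add_assoc, ih, Finset.sum_range_succ _ (n + 1)]
    simp only [Nat.add_eq_zero_iff, one_ne_zero, and_false, if_false, sub_zero, inner_sub_right,
      inner_sub_left]
    ring

/-- Summation by parts for differences of residuals. -/
theorem sum_inner_residual_sub (D : E → E) (y z x z' x' : ℕ → E) {N : ℕ} (hN : 1 ≤ N) :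
    ∑ j ∈ Finset.range (N + 1), (inner ℝ (y j) (residual D z x j - residual D z' x' j) : ℝ) =
      ∑ j ∈ Finset.range N, inner ℝ (y j - y (j + 1)) (z j - x j - (z' j - x' j))
        + inner ℝ (y N) (z N - x N - (z' N - x' N)) - inner ℝ (y 1) (D (x 0) - D (x' 0)) := by
  obtain ⟨n, rfl⟩ := Nat.exists_eq_add_of_le' hN
  rw [Finset.sum_range_succ', add_comm]
  rw [← sum_inner_residual_aux y (fun j => z j - x j - (z' j - x' j)) (D (x 0) - D (x' 0)) n]
  congr 1
  refine Finset.sum_congr rfl fun j _ => ?_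
  congr 1
  simp only [residual]
  split_ifs <;> abel

theorem sum_inner_residual (D : E → E) (y z x : ℕ → E) {N : ℕ} (hN : 1 ≤ N) :
    ∑ j ∈ Finset.range (N + 1), (inner ℝ (y j) (residual D z x j) : ℝ) =
      ∑ j ∈ Finset.range N, inner ℝ (y j - y (j + 1)) (z j - x j)
        + inner ℝ (y N) (z N - x N) - inner ℝ (y 1) (D (x 0)) := by
  obtain ⟨n, rfl⟩ := Nat.exists_eq_add_of_le' hN
  rw [Finset.sum_range_succ', add_comm]
  exact sum_inner_residual_aux y (fun j => z j - x j) (D (x 0)) n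

theorem sum_inner_sub_succ (y : ℕ → E) (n : ℕ) :
    ∑ j ∈ Finset.range n, (inner ℝ (y j - y (j + 1)) (y j) : ℝ) =
      (‖y 0‖ ^ 2 - ‖y n‖ ^ 2 + ∑ j ∈ Finset.range n, ‖y (j + 1) - y j‖ ^ 2) / 2 := by
  induction n with
  | zero => simp
  | succ n ih =>
    rw [Finset.sum_range_succ, ih, Finset.sum_range_succ, norm_sub_sq_real, inner_sub_left,
      real_inner_self_eq_norm_sq]
    ring

/-- The form has matrix `[[γ(1-γ), -γ], [-γ, 2γb]]`, whose determinant `γ²(2b(1-γ) - 1)` is positive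
exactly under the bound on `γ`. -/
theorem exists_quadratic_lower_bound {b γ : ℝ} (hb : 0 < b) (hγ : 0 < γ)
    (hγ' : γ < 1 - 1 / (2 * b)) :
    ∃ κ > 0, κ ≤ γ * (1 - γ) ∧ ∀ d e : ℝ,
      κ * (d ^ 2 + e ^ 2) ≤ γ * (1 - γ) * d ^ 2 - 2 * γ * (d * e) + 2 * γ * b * e ^ 2 := by
  have h1 : 0 < 2 * b * (1 - γ) - 1 := by
    have : 1 / (2 * b) < 1 - γ := by linarith
    rw [div_lt_iff₀ (by positivity)] at this
    linarith
  have h2 : 0 < 1 - γ := by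
    have : 0 < 1 / (2 * b) := by positivity
    linarith
  have ht : 0 < 1 - γ + 2 * b := by positivity
  -- Determinant over trace, a lower bound for the smaller eigenvalue. Subtracting `κ` times the
  -- identity leaves determinant `κ²`, the coefficient in the completed square below.
  set κ := γ * (2 * b * (1 - γ) - 1) / (1 - γ + 2 * b) with hκ
  have hκt : κ * (1 - γ + 2 * b) = γ * (2 * b * (1 - γ) - 1) := by
    rw [hκ]; field_simp
  have hκ0 : 0 < κ := by positivity
  have hα : 0 < γ * (1 - γ) - κ := by
    have : 0 < (γ * (1 - γ) - κ) * (1 - γ + 2 * b) := by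
      rw [sub_mul, hκt]
      have : γ * (1 - γ) * (1 - γ + 2 * b) - γ * (2 * b * (1 - γ) - 1)
        = γ * ((1 - γ) ^ 2 + 1) := by ring
      rw [this]; positivity
    exact pos_of_mul_pos_left this ht.le
  refine ⟨κ, hκ0, by linarith, fun d e => ?_⟩
  have h3 : 0 ≤ (γ * (1 - γ) - κ) *
      (γ * (1 - γ) * d ^ 2 - 2 * γ * (d * e) + 2 * γ * b * e ^ 2 - κ * (d ^ 2 + e ^ 2)) := by
    have : (γ * (1 - γ) - κ) *
      (γ * (1 - γ) * d ^ 2 - 2 * γ * (d * e) + 2 * γ * b * e ^ 2 - κ * (d ^ 2 + e ^ 2))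
      = ((γ * (1 - γ) - κ) * d - γ * e) ^ 2 + κ ^ 2 * e ^ 2 := by
      linear_combination (-γ * e ^ 2) * hκt
    rw [this]; positivity
  linarith [nonneg_of_mul_nonneg_right h3 hα]

variable {A : ℕ → E → Set E} {D : E → E} {N : ℕ}

/-- The Fejér inequality for one sweep of the ring iteration. -/
theorem IsSweep.fejer (hN : 1 ≤ N) (hA : ∀ j ≤ N, IsMonotoneOp (A j)) {b γ κ : ℝ}
    (hD : ∀ x y, b * ‖D x - D y‖ ^ 2 ≤ inner ℝ (x - y) (D x - D y)) (hγ : 0 < γ)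
    (hκ : κ ≤ γ * (1 - γ)) (hq : ∀ d e : ℝ,
      κ * (d ^ 2 + e ^ 2) ≤ γ * (1 - γ) * d ^ 2 - 2 * γ * (d * e) + 2 * γ * b * e ^ 2)
    {z x zs : ℕ → E} {w : E} (h : IsSweep A D N z x) (hs : IsSweep A D N zs fun _ => w) :
    ∑ j ∈ Finset.range N, ‖z j + γ • (x (j + 1) - x j) - zs j‖ ^ 2
        + κ * (∑ j ∈ Finset.range N, ‖x (j + 1) - x j‖ ^ 2 + ‖D (x 0) - D w‖ ^ 2) ≤
      ∑ j ∈ Finset.range N, ‖z j - zs j‖ ^ 2 := by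
  set y : ℕ → E := fun j => x j - w with hy
  set c := D (x 0) - D w with hc
  have hyd : ∀ j, y (j + 1) - y j = x (j + 1) - x j := fun j => by simp [hy]
  have hmono : 0 ≤ ∑ j ∈ Finset.range (N + 1),
      (inner ℝ (y j) (residual D z x j - residual D zs (fun _ => w) j) : ℝ) :=
    Finset.sum_nonneg fun j hj =>
      have hj' : j ≤ N := Nat.lt_succ_iff.1 (Finset.mem_range.1 hj)
      hA j hj' _ _ _ _ (h.mem j hj') (hs.mem j hj')
  rw [sum_inner_residual_sub D y z x zs _ hN] at hmono
  have e1 : ∑ j ∈ Finset.range N, (inner ℝ (y j - y (j + 1)) (z j - x j - (zs j - w)) : ℝ)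
      = ∑ j ∈ Finset.range N, (inner ℝ (y j - y (j + 1)) (z j - zs j) : ℝ)
        - (‖y 0‖ ^ 2 - ‖y N‖ ^ 2 + ∑ j ∈ Finset.range N, ‖x (j + 1) - x j‖ ^ 2) / 2 := by
    have := sum_inner_sub_succ y N
    simp only [hyd] at this
    rw [← this, ← Finset.sum_sub_distrib]
    refine Finset.sum_congr rfl fun j _ => ?_
    rw [← inner_sub_right]
    congr 1
    simp only [hy]; abel
  -- The closing condition turns the boundary term into norms; `‖y 0‖² - ‖y N‖²` cancels against
  -- `e1`, leaving a term of favourable sign.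
  have e2 : (inner ℝ (y N) (z N - x N - (zs N - w)) : ℝ)
      = (‖y 0‖ ^ 2 - ‖y N‖ ^ 2 - ‖y 0 - y N‖ ^ 2) / 2 := by
    have : z N - x N - (zs N - w) = y 0 - y N := by
      rw [h.closing, hs.closing]; simp only [hy]; abel
    rw [this, norm_sub_sq_real (y 0) (y N), inner_sub_right, real_inner_self_eq_norm_sq,
      real_inner_comm (y 0) (y N)]
    ring
  have e3 : ∑ j ∈ Finset.range N, ‖z j + γ • (x (j + 1) - x j) - zs j‖ ^ 2
      = ∑ j ∈ Finset.range N, ‖z j - zs j‖ ^ 2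
        - 2 * γ * ∑ j ∈ Finset.range N, (inner ℝ (y j - y (j + 1)) (z j - zs j) : ℝ)
        + γ ^ 2 * ∑ j ∈ Finset.range N, ‖x (j + 1) - x j‖ ^ 2 := by
    rw [Finset.mul_sum, Finset.mul_sum, ← Finset.sum_sub_distrib, ← Finset.sum_add_distrib]
    refine Finset.sum_congr rfl fun j _ => ?_
    have : z j + γ • (x (j + 1) - x j) - zs j = (z j - zs j) - γ • (y j - y (j + 1)) := by
      simp only [hy]; module
    rw [this, norm_sub_sq_real, inner_smul_right, norm_smul, mul_pow, Real.norm_eq_abs, sq_abs,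
      ← hyd, norm_sub_rev (y (j + 1)), real_inner_comm]
    ring
  -- `D` is evaluated at `x 0` but paired with `y 1`; the mismatch produces the cross term of the
  -- quadratic form.
  have e4 : b * ‖c‖ ^ 2 - ‖x 1 - x 0‖ * ‖c‖ ≤ inner ℝ (y 1) c := by
    have h1 := hD (x 0) w
    have h2 := neg_le_of_abs_le (abs_real_inner_le_norm (x 1 - x 0) c)
    have h3 : y 1 = (x 0 - w) + (x 1 - x 0) := by simp only [hy]; abel
    rw [h3, inner_add_left]
    linarith
  have e5 : κ * (∑ j ∈ Finset.range N, ‖x (j + 1) - x j‖ ^ 2 + ‖c‖ ^ 2)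
      ≤ γ * (1 - γ) * ∑ j ∈ Finset.range N, ‖x (j + 1) - x j‖ ^ 2
        - 2 * γ * (‖x 1 - x 0‖ * ‖c‖) + 2 * γ * b * ‖c‖ ^ 2 := by
    -- Only the difference of index 0 interacts with `c`; the others use `κ ≤ γ(1-γ)`.
    obtain ⟨n, rfl⟩ := Nat.exists_eq_add_of_le' hN
    rw [Finset.sum_range_succ']
    have h1 := hq ‖x (0 + 1) - x 0‖ ‖c‖
    have h2 : 0 ≤ ∑ j ∈ Finset.range n, ‖x (j + 1 + 1) - x (j + 1)‖ ^ 2 :=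
      Finset.sum_nonneg fun _ _ => sq_nonneg _
    have h3 := mul_le_mul_of_nonneg_right hκ h2
    rw [zero_add] at h1 ⊢
    linarith
  rw [e1, e2] at hmono
  rw [e3]
  have h6 := mul_le_mul_of_nonneg_left e4 hγ.le
  have h7 := mul_nonneg hγ.le hmono
  have h8 : 0 ≤ γ * ‖y 0 - y N‖ ^ 2 := by positivity
  linarith

end Ring

/-! ### Weak convergence of the ring iteration -/

section RingConvergence

variable {E ι : Type*} [NormedAddCommGroup E] [InnerProductSpace ℝ E]
variable {A : ℕ → E → Set E} {D : E → E} {N : ℕ}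

theorem tendsto_sub_zero_of_tendsto_succ_sub {ι E : Type*} [NormedAddCommGroup E]
    {N : ℕ} {F : Filter ι} {x : ι → ℕ → E}
    (hd : ∀ j < N, Tendsto (fun k => x k (j + 1) - x k j) F (𝓝 0)) :
    ∀ j ≤ N, Tendsto (fun k => x k j - x k 0) F (𝓝 0)
  | 0, _ => by simpa using tendsto_const_nhds
  | j + 1, hj => by
    have h1 := (hd j hj).add (tendsto_sub_zero_of_tendsto_succ_sub hd j (by omega))
    rw [add_zero] at h1
    exact h1.congr fun k => by abel

theorem weakTendsto_residual {F : Filter ι} {z x : ι → ℕ → E} {ζ : ℕ → E} {w : E}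
    (hz : ∀ j ≤ N, WeakTendsto (fun k => z k j) F (ζ j))
    (hx : ∀ j ≤ N, WeakTendsto (fun k => x k j) F w)
    (hD : Tendsto (fun k => D (x k 0)) F (𝓝 (D w))) :
    ∀ j ≤ N, WeakTendsto (fun k => residual D (z k) (x k) j) F (residual D ζ (fun _ => w) j)
  | 0, h => (hz 0 h).sub (hx 0 h)
  | j + 1, h => by
    refine (((hz (j + 1) h).sub (hx (j + 1) h)).sub ((hz j (by omega)).sub (hx j (by omega)))).sub
      (weakTendsto_of_tendsto ?_)
    split_ifs
    · exact hD
    · exact tendsto_const_nhds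

/-- Demiclosedness: weak limits of asymptotically regular sweeps are stationary sweeps. -/
theorem isSweep_of_weakTendsto (hN : 1 ≤ N) (hA : ∀ j ≤ N, IsMonotoneOp (A j))
    (hA' : ∀ j ≤ N, IsSurjResolvent (A j)) {F : Filter ι} [F.NeBot] {z x : ι → ℕ → E} {ζ : ℕ → E}
    {w : E} (h : ∀ k, IsSweep A D N (z k) (x k))
    (hd : ∀ j < N, Tendsto (fun k => x k (j + 1) - x k j) F (𝓝 0))
    (hD : Tendsto (fun k => D (x k 0)) F (𝓝 (D w)))
    {Cx Cz : ℕ → ℝ} (hCx : ∀ j ≤ N, ∀ k, ‖x k j‖ ≤ Cx j) (hCz : ∀ j ≤ N, ∀ k, ‖z k j‖ ≤ Cz j)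
    (hz : ∀ j < N, WeakTendsto (fun k => z k j) F (ζ j)) (hζ : ζ N = w)
    (hx : WeakTendsto (fun k => x k 0) F w) : IsSweep A D N ζ fun _ => w := by
  have hx0 := tendsto_sub_zero_of_tendsto_succ_sub hd
  have hxj : ∀ j ≤ N, WeakTendsto (fun k => x k j) F w := fun j hj => by
    have := (weakTendsto_of_tendsto (hx0 j hj)).add hx
    simpa only [sub_add_cancel, zero_add] using this
  have hzj : ∀ j ≤ N, WeakTendsto (fun k => z k j) F (ζ j) := fun j hj => by
    rcases hj.lt_or_eq with h1 | rfl
    · exact hz j h1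
    · simpa only [(h _).closing, hζ] using hx
  set ρ := residual D ζ fun _ => w with hρ
  have hr : ∀ j ≤ N, WeakTendsto (fun k => residual D (z k) (x k) j) F (ρ j) :=
    weakTendsto_residual hzj hxj hD
  -- Minty's trick: test monotonicity at the resolvent point `u j` of `ρ j + w`. Proving `u j = w`
  -- yields `ρ j ∈ A j w`.
  have hres : ∀ j, ∃ u, j ≤ N → ρ j + w - u ∈ A j u := fun j => by
    by_cases hj : j ≤ N
    · obtain ⟨u, hu⟩ := hA' j hj (ρ j + w)
      exact ⟨u, fun _ => hu⟩
    · exact ⟨0, fun h => absurd h hj⟩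
  choose u hu using hres
  have hy : ∀ j ≤ N, WeakTendsto (fun k => x k j - w) F 0 := fun j hj => by
    simpa using (hxj j hj).sub (weakTendsto_of_tendsto (tendsto_const_nhds (x := w)))
  have hyb : ∀ j ≤ N, ∀ k, ‖x k j - w‖ ≤ Cx j + ‖w‖ := fun j hj k =>
    (norm_sub_le _ _).trans (by gcongr; exact hCx j hj k)
  -- Each summand pairs two merely weakly convergent sequences; only the sum is controlled, since
  -- summation by parts puts a strongly convergent factor in every product.
  have hmain : Tendsto (fun k => ∑ j ∈ Finset.range (N + 1),
      (inner ℝ (x k j - w) (residual D (z k) (x k) j) : ℝ)) F (𝓝 0) := by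
    have h1 : Tendsto (fun k => ∑ j ∈ Finset.range N,
        (inner ℝ ((x k j - w) - (x k (j + 1) - w)) (z k j - x k j) : ℝ)) F
        (𝓝 (∑ j ∈ Finset.range N, 0)) := by
      refine tendsto_finsetSum _ fun j hj => ?_
      have hj' := Finset.mem_range.1 hj
      have h2 : Tendsto (fun k => (x k j - w) - (x k (j + 1) - w)) F (𝓝 0) := by
        have := (hd j hj').neg
        rw [neg_zero] at this
        exact this.congr fun k => by abel
      have h3 : ∀ k, ‖z k j - x k j‖ ≤ Cz j + Cx j := fun k =>
        (norm_sub_le _ _).trans (add_le_add (hCz j hj'.le k) (hCx j hj'.le k))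
      exact (tendsto_inner_zero_of_norm_le h3 h2).congr fun k => real_inner_comm _ _
    have h2 : Tendsto (fun k => (inner ℝ (x k N - w) (z k N - x k N) : ℝ)) F (𝓝 0) := by
      refine tendsto_inner_zero_of_norm_le (hyb N le_rfl) ?_
      have := (hx0 N le_rfl).neg
      rw [neg_zero] at this
      exact this.congr fun k => by rw [(h k).closing, neg_sub]
    have h3 := (hy 1 hN).inner (hyb 1 hN) hD
    have h4 := (h1.add h2).sub h3
    simp only [Finset.sum_const_zero, inner_zero_left, add_zero, sub_zero] at h4
    exact h4.congr fun k => (sum_inner_residual D (fun j => x k j - w) (z k) (x k) hN).symm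
  have hlim : Tendsto (fun k => ∑ j ∈ Finset.range (N + 1), (inner ℝ (x k j - u j)
      (residual D (z k) (x k) j - (ρ j + w - u j)) : ℝ)) F
      (𝓝 (-∑ j ∈ Finset.range (N + 1), ‖w - u j‖ ^ 2)) := by
    have h1 : Tendsto (fun k => ∑ j ∈ Finset.range (N + 1),
        ((inner ℝ (residual D (z k) (x k) j) (w - u j) : ℝ)
          - inner ℝ (x k j - w) (ρ j + w - u j))) F
        (𝓝 (∑ j ∈ Finset.range (N + 1), ((inner ℝ (ρ j) (w - u j) : ℝ)
          - inner ℝ (0 : E) (ρ j + w - u j)))) := by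
      refine tendsto_finsetSum _ fun j hj => ?_
      have hj' : j ≤ N := Nat.lt_succ_iff.1 (Finset.mem_range.1 hj)
      exact (hr j hj' _).sub (hy j hj' _)
    have h2 := (hmain.add h1).sub (tendsto_const_nhds
      (x := ∑ j ∈ Finset.range (N + 1), (inner ℝ (ρ j + w - u j) (w - u j) : ℝ)))
    have e : (0 : ℝ) + ∑ j ∈ Finset.range (N + 1), ((inner ℝ (ρ j) (w - u j) : ℝ)
          - inner ℝ (0 : E) (ρ j + w - u j))
        - ∑ j ∈ Finset.range (N + 1), (inner ℝ (ρ j + w - u j) (w - u j) : ℝ)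
        = -∑ j ∈ Finset.range (N + 1), ‖w - u j‖ ^ 2 := by
      rw [zero_add, ← Finset.sum_sub_distrib, ← Finset.sum_neg_distrib]
      refine Finset.sum_congr rfl fun j _ => ?_
      rw [add_sub_assoc, inner_add_left, real_inner_self_eq_norm_sq, inner_zero_left]
      ring
    rw [e] at h2
    refine h2.congr fun k => ?_
    rw [← Finset.sum_add_distrib, ← Finset.sum_sub_distrib]
    refine Finset.sum_congr rfl fun j _ => ?_
    have e1 : x k j - u j = (x k j - w) + (w - u j) := by abel
    rw [e1, inner_add_left, inner_sub_right (x k j - w) (residual D (z k) (x k) j),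
      inner_sub_right (w - u j) (residual D (z k) (x k) j),
      real_inner_comm (residual D (z k) (x k) j) (w - u j),
      real_inner_comm (ρ j + w - u j) (w - u j)]
    ring
  have hnn : 0 ≤ -∑ j ∈ Finset.range (N + 1), ‖w - u j‖ ^ 2 := by
    refine ge_of_tendsto' hlim fun k => Finset.sum_nonneg fun j hj => ?_
    have hj' : j ≤ N := Nat.lt_succ_iff.1 (Finset.mem_range.1 hj)
    exact hA j hj' _ _ _ _ ((h k).mem j hj') (hu j hj')
  have hzero := (Finset.sum_eq_zero_iff_of_nonneg (fun j _ => sq_nonneg ‖w - u j‖)).1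
    (le_antisymm (neg_nonneg.1 hnn) (Finset.sum_nonneg fun j _ => sq_nonneg ‖w - u j‖))
  refine ⟨fun j hj => ?_, hζ⟩
  have h1 : w - u j = 0 := by
    have := hzero j (Finset.mem_range.2 (Nat.lt_succ_iff.2 hj))
    exact norm_eq_zero.1 (pow_eq_zero_iff two_ne_zero |>.1 this)
  have h2 := hu j hj
  rw [← sub_eq_zero.1 h1, add_sub_cancel_right] at h2
  exact h2

/-- Weak convergence of the ring iteration. -/
theorem weakTendsto_ring_iteration [CompleteSpace E] (hN : 1 ≤ N)
    (hA : ∀ j ≤ N, IsMonotoneOp (A j)) (hA' : ∀ j ≤ N, IsSurjResolvent (A j)) {b γ : ℝ}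
    (hb : 0 < b) (hD : ∀ x y, b * ‖D x - D y‖ ^ 2 ≤ inner ℝ (x - y) (D x - D y)) (hγ : 0 < γ)
    (hγ' : γ < 1 - 1 / (2 * b)) {z x : ℕ → ℕ → E} (h : ∀ k, IsSweep A D N (z k) (x k))
    (hupd : ∀ k, ∀ j < N, z (k + 1) j = z k j + γ • (x k (j + 1) - x k j))
    (hsol : ∃ zs w, IsSweep A D N zs fun _ => w) :
    ∃ zs w, IsSweep A D N zs (fun _ => w) ∧ WeakTendsto (fun k => x k 0) atTop w := by
  obtain ⟨κ, hκ0, hκ, hq⟩ := exists_quadratic_lower_bound hb hγ hγ'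
  let V : (ℕ → E) → ℕ → ℝ := fun ζ k => ∑ j ∈ Finset.range N, ‖z k j - ζ j‖ ^ 2
  have hVnn : ∀ ζ k, 0 ≤ V ζ k := fun ζ k => Finset.sum_nonneg fun _ _ => sq_nonneg _
  have hfejer : ∀ ζ w, IsSweep A D N ζ (fun _ => w) → ∀ k, V ζ (k + 1)
      + κ * (∑ j ∈ Finset.range N, ‖x k (j + 1) - x k j‖ ^ 2 + ‖D (x k 0) - D w‖ ^ 2)
      ≤ V ζ k := by
    intro ζ w hs k
    have := (h k).fejer hN hA hD hγ hκ hq hs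
    refine le_trans (le_of_eq ?_) this
    congr 1
    exact Finset.sum_congr rfl fun j hj => by rw [hupd k j (Finset.mem_range.1 hj)]
  have hanti : ∀ ζ w, IsSweep A D N ζ (fun _ => w) → Antitone (V ζ) := by
    intro ζ w hs
    refine antitone_nat_of_succ_le fun k => ?_
    have h1 := hfejer ζ w hs k
    have h2 : 0 ≤ κ * (∑ j ∈ Finset.range N, ‖x k (j + 1) - x k j‖ ^ 2
      + ‖D (x k 0) - D w‖ ^ 2) := by positivity
    linarith
  have hVlim : ∀ ζ w, IsSweep A D N ζ (fun _ => w) → ∃ l, Tendsto (V ζ) atTop (𝓝 l) :=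
    fun ζ w hs => ⟨_, tendsto_atTop_ciInf (hanti ζ w hs)
      ⟨0, forall_mem_range.2 fun k => hVnn ζ k⟩⟩
  obtain ⟨zs, ws, hs⟩ := hsol
  have hS : Tendsto (fun k => ∑ j ∈ Finset.range N, ‖x k (j + 1) - x k j‖ ^ 2
      + ‖D (x k 0) - D ws‖ ^ 2) atTop (𝓝 0) := by
    obtain ⟨l, hl⟩ := hVlim zs ws hs
    have h1 : Tendsto (fun k => κ⁻¹ * (V zs k - V zs (k + 1))) atTop (𝓝 0) := by
      simpa using (hl.sub (hl.comp (tendsto_add_atTop_nat 1))).const_mul κ⁻¹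
    refine squeeze_zero (fun k => by positivity) (fun k => ?_) h1
    rw [le_inv_mul_iff₀ hκ0]
    linarith [hfejer zs ws hs k]
  have hzero_of_sq : ∀ a : ℕ → E, (∀ k, ‖a k‖ ^ 2 ≤ ∑ j ∈ Finset.range N,
      ‖x k (j + 1) - x k j‖ ^ 2 + ‖D (x k 0) - D ws‖ ^ 2) → Tendsto a atTop (𝓝 0) := by
    intro a ha
    have h1 := (squeeze_zero (fun k => sq_nonneg ‖a k‖) ha hS).sqrt
    rw [Real.sqrt_zero] at h1
    exact tendsto_zero_iff_norm_tendsto_zero.2 (h1.congr fun k => Real.sqrt_sq (norm_nonneg _))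
  have hd : ∀ j < N, Tendsto (fun k => x k (j + 1) - x k j) atTop (𝓝 0) := by
    intro j hj
    refine hzero_of_sq _ fun k => ?_
    have := Finset.single_le_sum (f := fun j => ‖x k (j + 1) - x k j‖ ^ 2)
      (fun _ _ => sq_nonneg _) (Finset.mem_range.2 hj)
    linarith [sq_nonneg ‖D (x k 0) - D ws‖]
  have hDlim : Tendsto (fun k => D (x k 0)) atTop (𝓝 (D ws)) := by
    rw [tendsto_iff_norm_sub_tendsto_zero, ← tendsto_zero_iff_norm_tendsto_zero]
    refine hzero_of_sq _ fun k => le_add_of_nonneg_left ?_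
    exact Finset.sum_nonneg fun _ _ => sq_nonneg _
  have hzb : ∀ j < N, ∀ k, ‖z k j - zs j‖ ≤ √(V zs 0) := fun j hj k => by
    refine Real.le_sqrt_of_sq_le (le_trans ?_ (hanti zs ws hs (Nat.zero_le k)))
    exact Finset.single_le_sum (f := fun j => ‖z k j - zs j‖ ^ 2)
      (fun _ _ => sq_nonneg _) (Finset.mem_range.2 hj)
  -- Nonexpansiveness of the resolvent of `A 0`.
  have hx0b : ∀ k, ‖x k 0 - ws‖ ≤ ‖z k 0 - zs 0‖ := fun k => by
    have h1 := hA 0 (Nat.zero_le N) _ _ _ _ ((h k).mem 0 (Nat.zero_le N)) (hs.mem 0 (Nat.zero_le N))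
    have e : residual D (z k) (x k) 0 - residual D zs (fun _ => ws) 0
        = (z k 0 - zs 0) - (x k 0 - ws) := by simp only [residual]; abel
    rw [e, inner_sub_right, real_inner_self_eq_norm_sq] at h1
    have h2 := real_inner_le_norm (x k 0 - ws) (z k 0 - zs 0)
    by_contra! hlt
    nlinarith [norm_nonneg (z k 0 - zs 0)]
  have hCx : ∀ j, ∃ C, j ≤ N → ∀ k, ‖x k j‖ ≤ C := fun j => by
    by_cases hj : j ≤ N
    · obtain ⟨C, hC⟩ := (Metric.isBounded_range_of_tendsto _
        (tendsto_sub_zero_of_tendsto_succ_sub hd j hj)).exists_norm_le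
      refine ⟨C + (√(V zs 0) + ‖ws‖), fun _ k => ?_⟩
      have h1 := hC _ (mem_range_self k)
      have h2 := (hx0b k).trans (hzb 0 hN k)
      have e : x k j = (x k j - x k 0) + ((x k 0 - ws) + ws) := by abel
      rw [e]
      exact (norm_add_le _ _).trans (add_le_add h1 ((norm_add_le _ _).trans (by gcongr)))
    · exact ⟨0, fun h => absurd h hj⟩
  choose Cx hCx using hCx
  have hCz : ∀ j, ∃ C, j ≤ N → ∀ k, ‖z k j‖ ≤ C := fun j => by
    rcases lt_trichotomy j N with hj | rfl | hj
    · refine ⟨√(V zs 0) + ‖zs j‖, fun _ k => ?_⟩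
      rw [← sub_add_cancel (z k j) (zs j)]
      exact (norm_add_le _ _).trans (by gcongr; exact hzb j hj k)
    · exact ⟨Cx 0, fun _ k => by rw [(h k).closing]; exact hCx 0 (Nat.zero_le _) k⟩
    · exact ⟨0, fun h => absurd h (not_le.2 hj)⟩
  choose Cz hCz using hCz
  -- Ultrafilters finer than `atTop` replace weakly convergent subsequences.
  have hcluster : ∀ U : Ultrafilter ℕ, (U : Filter ℕ) ≤ atTop → ∃ ζ w,
      IsSweep A D N ζ (fun _ => w) ∧ WeakTendsto (fun k => x k 0) U w ∧
      ∀ j < N, WeakTendsto (fun k => z k j) U (ζ j) := by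
    intro U hU
    obtain ⟨w, hw⟩ := exists_weakTendsto_ultrafilter U (hCx 0 (Nat.zero_le N))
    have hζ : ∀ j, ∃ ζ, (j < N → WeakTendsto (fun k => z k j) U ζ) ∧ (j = N → ζ = w) := fun j => by
      by_cases hj : j < N
      · obtain ⟨ζ, hζ⟩ := exists_weakTendsto_ultrafilter U (hCz j hj.le)
        exact ⟨ζ, fun _ => hζ, fun h => absurd h hj.ne⟩
      · exact ⟨w, fun h => absurd h hj, fun _ => rfl⟩
    choose ζ hζ hζN using hζ
    -- Cocoercivity between `x k 0` and `w`: the right side pairs a weakly null sequence with a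
    -- strongly convergent one, so it vanishes in the limit.
    have hDw : D ws = D w := by
      have h1 : Tendsto (fun k => D (x k 0) - D w) U (𝓝 (D ws - D w)) :=
        (hDlim.mono_left hU).sub_const _
      have h2 : WeakTendsto (fun k => x k 0 - w) U 0 := by
        simpa using hw.sub (weakTendsto_of_tendsto (tendsto_const_nhds (x := w)))
      have h3 := h2.inner (C := Cx 0 + ‖w‖) (fun k => (norm_sub_le _ _).trans
        (by gcongr; exact hCx 0 (Nat.zero_le N) k)) h1
      rw [inner_zero_left] at h3
      have h4 := le_of_tendsto_of_tendsto' ((h1.norm.pow 2).const_mul b) h3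
        fun k => hD (x k 0) w
      have h5 : ‖D ws - D w‖ ^ 2 ≤ 0 := nonpos_of_mul_nonpos_right h4 hb
      exact sub_eq_zero.1 (norm_eq_zero.1
        (pow_eq_zero_iff two_ne_zero |>.1 (le_antisymm h5 (sq_nonneg _))))
    refine ⟨ζ, w, ?_, hw, hζ⟩
    exact isSweep_of_weakTendsto hN hA hA' h (fun j hj => (hd j hj).mono_left hU)
      (hDw ▸ hDlim.mono_left hU) hCx hCz hζ (hζN N rfl) hw
  obtain ⟨ζ₀, w₀, hs₀, hw₀, hζ₀⟩ := hcluster (Ultrafilter.of atTop) (Ultrafilter.of_le atTop)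
  refine ⟨ζ₀, w₀, hs₀, fun v => ?_⟩
  rw [tendsto_iff_ultrafilter]
  intro U hU
  obtain ⟨ζ, w, hs', hw, hζ⟩ := hcluster U hU
  -- Opial: expanding the difference of the two convergent Fejér distances leaves this linear
  -- functional of the iterates. Its limits along both ultrafilters agree, which forces `ζ j = ζ₀ j`
  -- for `j < N`.
  have hsum : ∃ l, Tendsto (fun k => ∑ j ∈ Finset.range N, (inner ℝ (z k j) (ζ j - ζ₀ j) : ℝ))
      atTop (𝓝 l) := by
    obtain ⟨l, hl⟩ := hVlim ζ w hs'
    obtain ⟨l₀, hl₀⟩ := hVlim ζ₀ w₀ hs₀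
    refine ⟨_, (((hl₀.sub hl).add_const
      (∑ j ∈ Finset.range N, (‖ζ j‖ ^ 2 - ‖ζ₀ j‖ ^ 2))).const_mul (1 / 2)).congr fun k => ?_⟩
    simp only [V]
    rw [← Finset.sum_sub_distrib, ← Finset.sum_add_distrib, Finset.mul_sum]
    refine Finset.sum_congr rfl fun j _ => ?_
    rw [norm_sub_sq_real, norm_sub_sq_real, inner_sub_right]
    ring
  obtain ⟨l, hl⟩ := hsum
  have e1 := tendsto_nhds_unique (hl.mono_left hU) (tendsto_finsetSum _ fun j hj =>
    hζ j (Finset.mem_range.1 hj) (ζ j - ζ₀ j))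
  have e2 := tendsto_nhds_unique (hl.mono_left (Ultrafilter.of_le atTop))
    (tendsto_finsetSum _ fun j hj => hζ₀ j (Finset.mem_range.1 hj) (ζ j - ζ₀ j))
  have e3 : ∑ j ∈ Finset.range N, ‖ζ j - ζ₀ j‖ ^ 2 = 0 := by
    rw [← sub_eq_zero.2 (e1.symm.trans e2), ← Finset.sum_sub_distrib]
    refine Finset.sum_congr rfl fun j _ => ?_
    rw [← inner_sub_left, real_inner_self_eq_norm_sq]
  have e4 : ζ 0 = ζ₀ 0 := by
    have := (Finset.sum_eq_zero_iff_of_nonneg (fun j _ => sq_nonneg ‖ζ j - ζ₀ j‖)).1 e3 0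
      (Finset.mem_range.2 hN)
    exact sub_eq_zero.1 (norm_eq_zero.1 (pow_eq_zero_iff two_ne_zero |>.1 this))
  -- `w` and `w₀` are both resolvents of `A 0` at the same point `ζ 0`.
  have e5 : w = w₀ := by
    have h1 := hA 0 (Nat.zero_le N) _ _ _ _ (hs'.mem 0 (Nat.zero_le N)) (hs₀.mem 0 (Nat.zero_le N))
    have e : residual D ζ (fun _ => w) 0 - residual D ζ₀ (fun _ => w₀) 0 = -(w - w₀) := by
      simp only [residual, e4]; abel
    rw [e, inner_neg_right, real_inner_self_eq_norm_sq] at h1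
    exact sub_eq_zero.1 (norm_eq_zero.1
      (pow_eq_zero_iff two_ne_zero |>.1 (le_antisymm (neg_nonneg.1 h1) (sq_nonneg _))))
  rw [← e5]
  exact hw v

end RingConvergence

/-! ### The routine as a ring iteration -/

section Routine

theorem sum_residual {E : Type*} [NormedAddCommGroup E] (D : E → E) (z x : ℕ → E) (n : ℕ) :
    ∑ j ∈ Finset.range (n + 1), residual D z x (j + 1) + residual D z x 0
      = z (n + 1) - x (n + 1) - D (x 0) := by
  induction n with
  | zero => simp [residual]; abel
  | succ n ih =>
    rw [Finset.sum_range_succ, add_right_comm, ih]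
    simp [residual]

variable {H : Type*} [NormedAddCommGroup H] [InnerProductSpace ℝ H] {N : ℕ}

/-- The operators of the inclusion in the order in which the routine visits them, the operators
`opB` being scaled. -/
def ringOp (Q : Set H) (f : Fin N → H → ℝ) (lam : ℝ) : ℕ → Space H N → Set (Space H N)
  | 0 => opA₁ Q
  | j + 1 => fun x => if hj : j < N then lam • opB f ⟨j, hj⟩ x else univ

/-- Sweeps involve only indices up to `N`, so the default `univ` beyond that range never matters. -/
theorem ringOp_succ (Q : Set H) (f : Fin N → H → ℝ) (lam : ℝ) {j : ℕ} (hj : j < N) :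
    ringOp Q f lam (j + 1) = fun x => lam • opB f ⟨j, hj⟩ x := by
  funext x
  exact dif_pos hj

theorem isMonotoneOp_ringOp (Q : Set H) (f : Fin N → H → ℝ) {lam : ℝ} (hlam : 0 < lam) :
    ∀ j ≤ N, IsMonotoneOp (ringOp Q f lam j)
  | 0, _ => isMonotoneOp_opA₁ Q
  | j + 1, hj => by
    rw [ringOp_succ Q f lam hj]
    exact (isMonotoneOp_opB f _).smul hlam.le

variable [CompleteSpace H]

theorem isSurjResolvent_ringOp (hN : 0 < N) {Q : Set H} (hne : Q.Nonempty) (hconv : Convex ℝ Q)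
    (hcl : IsClosed Q) {f : Fin N → H → ℝ} (hf : ∀ i, ConvexOn ℝ univ (f i))
    (hlsc : ∀ i, LowerSemicontinuous (f i)) {lam : ℝ} (hlam : 0 < lam) :
    ∀ j ≤ N, IsSurjResolvent (ringOp Q f lam j)
  | 0, _ => fun x => ⟨_, sub_proj_mem_opA₁ hN hne hconv hcl x⟩
  | j + 1, hj => by
    rw [ringOp_succ Q f lam hj]
    exact isSurjResolvent_smul_opB f _ (hf _) (hlsc _) hlam

/-- Scaling by `λ` divides the cocoercivity constant: this is the `b = β / λ` of the ring iteration.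
-/
theorem cocoercive_smul_opC {h : H → ℝ} (hconv : ConvexOn ℝ univ h) (hd : Differentiable ℝ h)
    {β : ℝ} (hβ : 0 < β) (hlip : ∀ x y, ‖gradient h x - gradient h y‖ ≤ β⁻¹ * ‖x - y‖)
    {lam : ℝ} (hlam : 0 < lam) (x y : Space H N) :
    β / lam * ‖lam • opC h x - lam • opC h y‖ ^ 2
      ≤ inner ℝ (x - y) (lam • opC h x - lam • opC h y) := by
  have h1 := cocoercive_gradient hconv hd hβ hlip x.fst y.fst
  have e1 : opC h x - opC h y
      = WithLp.toLp 2 (gradient h x.fst - gradient h y.fst, (0 : EuclideanSpace ℝ (Fin N))) := by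
    refine WithLp.ofLp_injective 2 (Prod.ext rfl ?_)
    exact sub_self _
  have e2 : inner ℝ (x - y) (opC h x - opC h y)
      = inner ℝ (x.fst - y.fst) (gradient h x.fst - gradient h y.fst) := by
    rw [e1, WithLp.prod_inner_apply]
    simp
  have e3 : ‖opC h x - opC h y‖ ^ 2 = ‖gradient h x.fst - gradient h y.fst‖ ^ 2 := by
    rw [e1, WithLp.prod_norm_sq_eq_of_L2]
    simp
  rw [← smul_sub, inner_smul_right, norm_smul, mul_pow, e2, e3, Real.norm_eq_abs, sq_abs]
  have e4 : β / lam * (lam ^ 2 * ‖gradient h x.fst - gradient h y.fst‖ ^ 2)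
      = lam * (β * ‖gradient h x.fst - gradient h y.fst‖ ^ 2) := by field_simp
  rw [e4]
  exact mul_le_mul_of_nonneg_left h1 hlam.le

theorem sum_opCi (hN : 0 < N) (h : H → ℝ) (z : Space H N) : ∑ i, opCi h i z = opC h z := by
  rw [Finset.sum_eq_single_of_mem (⟨0, hN⟩ : Fin N) (Finset.mem_univ _)]
  · simp [opCi]
  · intro i _ hi
    exact if_neg fun h0 => hi (Fin.ext h0)

/-- Solutions of the inclusion are the stationary sweeps of the routine. -/
theorem isSolution_iff_exists_isSweep (hN : 0 < N) (Q : Set H) (h : H → ℝ) (f : Fin N → H → ℝ)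
    {lam : ℝ} (hlam : 0 < lam) (w : Space H N) :
    IsSolution Q h f w ↔
      ∃ zs, IsSweep (ringOp Q f lam) (fun x => lam • opC h x) N zs fun _ => w := by
  obtain ⟨n, rfl⟩ := Nat.exists_eq_add_of_le' hN
  constructor
  · rintro ⟨_, ⟨a, ha, s, hs, rfl⟩, _, rfl, hsum⟩
    obtain ⟨g, hg, rfl⟩ := (mem_fintype_sum _ _).1 hs
    simp only [sum_opCi hN] at hsum
    let G : ℕ → Space H (n + 1) := fun j => if hj : j < n + 1 then g ⟨j, hj⟩ else 0
    -- Solves the recursion that prescribes the residuals `lam • a` and `lam • G j`; the closing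
    -- condition then amounts to the inclusion itself.
    let zs : ℕ → Space H (n + 1) := fun j => Nat.rec (w + lam • a)
      (fun j r => r + lam • G j + if j = 0 then lam • opC h w else 0) j
    have hres : ∀ j, residual (fun x => lam • opC h x) zs (fun _ => w) (j + 1) = lam • G j := by
      intro j
      simp only [residual, zs]
      abel
    have hres0 : residual (fun x => lam • opC h x) zs (fun _ => w) 0 = lam • a := by
      simp [residual, zs]
    refine ⟨zs, ?_, ?_⟩
    · rintro (_ | j) hj
      · rw [hres0]
        change lam • a ∈ opA₁ Q w
        rw [← smul_opA₁ Q hlam]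
        exact smul_mem_smul_set ha
      · rw [hres, ringOp_succ Q f lam hj]
        simp only [G, dif_pos (show j < n + 1 from hj)]
        exact smul_mem_smul_set (hg _)
    · have h1 := sum_residual (fun x => lam • opC h x) zs (fun _ => w) n
      simp only [hres, hres0] at h1
      have h2 : ∑ j ∈ Finset.range (n + 1), G j = ∑ i, g i := by
        rw [Finset.sum_range]
        exact Finset.sum_congr rfl fun i _ => dif_pos i.2
      rw [← Finset.smul_sum, h2] at h1
      have h3 : zs (n + 1) - w = lam • (a + ∑ i, g i + opC h w) := by
        rw [smul_add, smul_add, add_comm (lam • a), h1, sub_add_cancel]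
      rw [hsum, smul_zero] at h3
      exact sub_eq_zero.1 h3
  · rintro ⟨zs, hs⟩
    set r := residual (fun x => lam • opC h x) zs (fun _ => w) with hr
    have h1 := sum_residual (fun x => lam • opC h x) zs (fun _ => w) n
    rw [hs.closing, sub_self, zero_sub, ← hr] at h1
    refine ⟨lam⁻¹ • r 0 + ∑ i : Fin (n + 1), lam⁻¹ • r (i + 1),
      ⟨lam⁻¹ • r 0, ?_, ∑ i : Fin (n + 1), lam⁻¹ • r (i + 1), ?_, rfl⟩, _, rfl, ?_⟩
    · rw [← smul_opA₁ Q (inv_pos.2 hlam)]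
      exact smul_mem_smul_set (hs.mem 0 (Nat.zero_le _))
    · refine (mem_fintype_sum _ _).2 ⟨fun i => lam⁻¹ • r (i + 1), fun i => ?_, rfl⟩
      have h2 := hs.mem (i + 1) i.2
      rw [ringOp_succ Q f lam i.2] at h2
      exact (mem_smul_set_iff_inv_smul_mem₀ hlam.ne' _ _).1 h2
    · simp only [sum_opCi hN]
      rw [Finset.sum_range] at h1
      rw [← Finset.smul_sum, ← smul_add, add_comm (r 0), h1, smul_neg, inv_smul_smul₀ hlam.ne',
        neg_add_cancel]

/-- Each step of the routine is a sweep of the ring iteration. -/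
theorem IsDistributedFB.exists_isSweep (hN : 2 ≤ N) {Q : Set H} (hne : Q.Nonempty)
    (hconv : Convex ℝ Q) (hcl : IsClosed Q) {h : H → ℝ} {f : Fin N → H → ℝ}
    (hf : ∀ i, ConvexOn ℝ univ (f i)) (hlsc : ∀ i, LowerSemicontinuous (f i)) {lam γ : ℝ}
    (hlam : 0 < lam) {zbar : ℕ → Fin N → Space H N} {z : ℕ → Fin (N + 1) → Space H N}
    (hz : IsDistributedFB hN Q h f lam γ zbar z) :
    ∃ u x : ℕ → ℕ → Space H N, (∀ k, x k 0 = z k 0) ∧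
      (∀ k, IsSweep (ringOp Q f lam) (fun x => lam • opC h x) N (u k) (x k)) ∧
      ∀ k, ∀ j < N, u (k + 1) j = u k j + γ • (x k (j + 1) - x k j) := by
  -- The added entry `u k N = z k 0` gives the last resolvent step the form of the middle ones. It
  -- is not updated by `γ`, so the update rule is claimed only for `j < N`.
  let u : ℕ → ℕ → Space H N := fun k j => if hj : j < N then zbar k ⟨j, hj⟩ else z k 0
  let x : ℕ → ℕ → Space H N := fun k j => if hj : j < N + 1 then z k ⟨j, hj⟩ else 0
  have hu : ∀ k j (hj : j < N), u k j = zbar k ⟨j, hj⟩ := fun k j hj => dif_pos hj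
  have huN : ∀ k, u k N = z k 0 := fun k => dif_neg (lt_irrefl N)
  have hx : ∀ k j (hj : j < N + 1), x k j = z k ⟨j, hj⟩ := fun k j hj => dif_pos hj
  have hx0 : ∀ k, x k 0 = z k 0 := fun k => hx k 0 (Nat.succ_pos N)
  refine ⟨u, x, hx0, fun k => ⟨?_, ?_⟩, fun k j hj => ?_⟩
  · rintro (_ | j) hj
    · change u k 0 - x k 0 ∈ opA₁ Q (x k 0)
      rw [hu k 0 (by omega), hx0, hz.proj_step]
      exact sub_proj_mem_opA₁ (by omega) hne hconv hcl _
    · have hsurj := isSurjResolvent_smul_opB f ⟨j, hj⟩ (hf _) (hlsc _) hlam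
      rw [ringOp_succ Q f lam hj]
      have key : ∀ v, z k ⟨j + 1, by omega⟩ = resolvent (fun y => lam • opB f ⟨j, hj⟩ y) v →
          residual (fun x => lam • opC h x) (u k) (x k) (j + 1) = v - x k (j + 1) →
          residual (fun x => lam • opC h x) (u k) (x k) (j + 1)
            ∈ lam • opB f ⟨j, hj⟩ (x k (j + 1)) := by
        intro v hv hres
        rw [hres, hx k (j + 1) (by omega), hv]
        exact sub_resolvent_mem hsurj v
      rcases Nat.eq_zero_or_pos j with rfl | hpos
      · refine key _ (hz.first_step k) ?_
        simp only [residual, if_true, hu k 1 (by omega), hu k 0 (by omega), hx0]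
        abel
      · rcases (show j + 1 < N ∨ j + 1 = N by omega) with hlt | heq
        · refine key _ (hz.middle_step k j hpos hlt) ?_
          simp only [residual, if_neg hpos.ne', hu k (j + 1) hlt, hu k j hj, hx k j (by omega)]
          abel
        · have hjN : j = N - 1 := by omega
          subst hjN
          have e : (⟨N - 1 + 1, by omega⟩ : Fin (N + 1)) = ⟨N, by omega⟩ := Fin.ext heq
          refine key _ ((congrArg (z k) e).trans (hz.last_step k)) ?_
          have e2 : u k (N - 1 + 1) = z k 0 := by rw [heq, huN]
          simp only [residual, if_neg hpos.ne', e2, hu k (N - 1) hj, hx k (N - 1) (by omega)]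
          abel
  · rw [huN, hx0]
  · rw [hu _ j hj, hu _ j hj, hz.update, hx k (j + 1) (by omega), hx k j (by omega)]
    rfl

end Routine

end DRO

theorem mainTheorem8 {H : Type*} [NormedAddCommGroup H] [InnerProductSpace ℝ H] [CompleteSpace H]
    {N : ℕ} (hN : 2 ≤ N)
    (Q : Set H) (hQne : Q.Nonempty) (hQconv : Convex ℝ Q) (hQclosed : IsClosed Q)
    (h : H → ℝ) (β : ℝ) (hβ : 0 < β) (hconv : ConvexOn ℝ Set.univ h) (hdiff : Differentiable ℝ h)
    (hlip : ∀ x y, ‖gradient h x - gradient h y‖ ≤ β⁻¹ * ‖x - y‖)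
    (f : Fin N → H → ℝ) (hfconv : ∀ i, ConvexOn ℝ Set.univ (f i))
    (hflsc : ∀ i, LowerSemicontinuous (f i))
    (hsol : ∃ z : DRO.Space H N, DRO.IsSolution Q h f z)
    (lam : ℝ) (hlam : lam ∈ Set.Ioo 0 (2 * β))
    (γ : ℝ) (hγ : γ ∈ Set.Ioo 0 (1 - lam / (2 * β)))
    (zbar : ℕ → Fin N → DRO.Space H N) (z : ℕ → Fin (N + 1) → DRO.Space H N)
    (hz : DRO.IsDistributedFB hN Q h f lam γ zbar z) :
    ∃ w : DRO.Space H N, DRO.IsSolution Q h f w ∧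
      Tendsto (fun k => toWeakSpace ℝ (DRO.Space H N) (z k 0)) atTop
        (𝓝 (toWeakSpace ℝ (DRO.Space H N) w)) := by
  obtain ⟨hlam0, -⟩ := hlam
  have hN0 : 0 < N := by omega
  obtain ⟨u, x, hx0, hsweep, hupd⟩ := hz.exists_isSweep hN hQne hQconv hQclosed hfconv hflsc hlam0
  have hsol' : ∃ zs w, DRO.IsSweep (DRO.ringOp Q f lam) (fun x => lam • DRO.opC h x) N zs
      fun _ => w := by
    obtain ⟨w, hw⟩ := hsol
    obtain ⟨zs, hzs⟩ := (DRO.isSolution_iff_exists_isSweep hN0 Q h f hlam0 w).1 hw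
    exact ⟨zs, w, hzs⟩
  have hγ' : γ < 1 - 1 / (2 * (β / lam)) := by
    have e : 1 / (2 * (β / lam)) = lam / (2 * β) := by field_simp
    rw [e]
    exact hγ.2
  obtain ⟨zs, w, hs, hw⟩ := DRO.weakTendsto_ring_iteration hN0
    (DRO.isMonotoneOp_ringOp Q f hlam0)
    (DRO.isSurjResolvent_ringOp hN0 hQne hQconv hQclosed hfconv hflsc hlam0) (div_pos hβ hlam0)
    (DRO.cocoercive_smul_opC hconv hdiff hβ hlip hlam0) hγ.1 hγ' hsweep hupd hsol'
  refine ⟨w, (DRO.isSolution_iff_exists_isSweep hN0 Q h f hlam0 w).2 ⟨zs, hs⟩, ?_⟩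
  simpa only [hx0] using DRO.tendsto_toWeakSpace_of_weakTendsto hw
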